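/- Let $K$ be a finite simplicial complex that is connected (in particular nonempty), and let $L$, $M$ be subcomplexes with $K=L\cup M$. (Simplicial complexes are identified with their geometric realizations.) Suppose that all connected components of $L$ and of $M$ are contractible: $L=\coprod_{i=1}^{l}L_i$ and $M=\coprod_{j=1}^{m}M_j$ are disjoint unions of subcomplexes, with every $L_i$ and every $M_j$ contractible. Put $$n=\#\{(i,j)\mid L_i\cap M_j\neq\emptyset\}-l-m+1 .$$ Then $n\ge 0$, and there is a homotopy equivalence $$K\;\simeq\;\Bigl(\bigvee_{\substack{i,j\\ L_i\cap M_j\neq\emptyset}} S(L_i\cap M_j)\Bigr)\vee\Bigl(\bigvee_{n}S^1\Bigr).$$ Here $SX$ is the unreduced suspension, i.e. $X\times[0,1]$ with $X\times\{0\}$ collapsed to one point and $X\times\{1\}$ collapsed to another point; $\bigvee_n S^1$ is the wedge of $n$ circles; the wedge of an empty family is a point; and the base points in the suspensions and the circles may be chosen arbitrarily. -/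

import Mathlib

open scoped unitInterval ContinuousMap

/-- The geometric realization of an abstract simplicial complex `K` in barycentric coordinates:
the families of nonnegative weights on the vertices, supported on a face of `K` and summing to `1`.
It is regarded as a subspace of `V → ℝ`; for a complex with finitely many faces this is the usual
topology. -/
def PreAbstractSimplicialComplex.realization {V : Type*} (K : PreAbstractSimplicialComplex V) :
    Set (V → ℝ) :=
  {x | (∀ v, 0 ≤ x v) ∧ ∃ s ∈ K.faces, (∀ v, v ∉ s → x v = 0) ∧ ∑ v ∈ s, x v = 1}

/-- The identifications on `X × [0,1]` defining the unreduced suspension: each of the two ends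
is collapsed to a point. -/
def suspensionRel (X : Type*) (a b : X × I) : Prop :=
  (a.2 = 0 ∧ b.2 = 0) ∨ (a.2 = 1 ∧ b.2 = 1)

/-- The unreduced suspension of a (nonempty) space, with the quotient topology. -/
def Suspension (X : Type*) : Type _ := Quot (suspensionRel X)

instance Suspension.instTopologicalSpace (X : Type*) [TopologicalSpace X] :
    TopologicalSpace (Suspension X) :=
  inferInstanceAs (TopologicalSpace (Quot (suspensionRel X)))

/-- The identifications defining the wedge sum: the base points `p i` of all the spaces `X i` are
glued to one extra point, the base point of the wedge. -/
inductive wedgeRel {ι : Type*} (X : ι → Type*) (p : ∀ i, X i) :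
    Unit ⊕ (Σ i, X i) → Unit ⊕ (Σ i, X i) → Prop
  | glue (i : ι) : wedgeRel X p (Sum.inl ()) (Sum.inr ⟨i, p i⟩)

/-- The wedge sum of a family of pointed spaces, with the quotient topology. The wedge of the empty
family is a point. -/
def Wedge {ι : Type*} (X : ι → Type*) (p : ∀ i, X i) : Type _ := Quot (wedgeRel X p)

instance Wedge.instTopologicalSpace {ι : Type*} (X : ι → Type*) [∀ i, TopologicalSpace (X i)]
    (p : ∀ i, X i) : TopologicalSpace (Wedge X p) :=
  inferInstanceAs (TopologicalSpace (Quot (wedgeRel X p)))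

/-- The common base point of a wedge sum. -/
def Wedge.base {ι : Type*} (X : ι → Type*) (p : ∀ i, X i) : Wedge X p :=
  Quot.mk _ (Sum.inl ())

/-- The identification defining the wedge sum of two pointed spaces. -/
inductive wedgeTwoRel {X Y : Type*} (x : X) (y : Y) : X ⊕ Y → X ⊕ Y → Prop
  | glue : wedgeTwoRel x y (Sum.inl x) (Sum.inr y)

/-- The wedge sum `X ∨ Y` of two pointed spaces, with the quotient topology. -/
def WedgeTwo {X Y : Type*} (x : X) (y : Y) : Type _ := Quot (wedgeTwoRel x y)

instance WedgeTwo.instTopologicalSpace {X Y : Type*} [TopologicalSpace X] [TopologicalSpace Y]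
    (x : X) (y : Y) : TopologicalSpace (WedgeTwo x y) :=
  inferInstanceAs (TopologicalSpace (Quot (wedgeTwoRel x y)))

/-- The pairs `(i, j)` for which the complexes `A i` and `B j` have nonempty intersection. -/
abbrev IntersectingPairs {V : Type*} {l m : ℕ} (A : Fin l → PreAbstractSimplicialComplex V)
    (B : Fin m → PreAbstractSimplicialComplex V) : Type :=
  {ij : Fin l × Fin m // (A ij.1 ⊓ B ij.2).faces.Nonempty}

/-! By homotopy extension for subcomplexes, `K` is equivalent to its double mapping cylinder `L × 0
∪ (L ∩ M) × [0,1] ∪ M × 1`. Since the components are pairwise disjoint, this space is the disjoint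
union of all `A i` and `B j` with a cylinder on each nonempty `A i ∩ B j` running from `A i` to `B
j`: a homotopy coequalizer.

Contracting every `A i` and `B j` to a point turns each cylinder into a suspension whose poles are
tied by arcs to the points `i` and `j` (`HCoeq.nonempty_equiv_suspensionGraph`). Inside a suspension
the ends of both arcs can be slid from the poles to any prescribed point `p e`, because homotopic
attaching maps give equivalent coequalizers (`HCoeq.nonempty_equiv_of_homotopy`).

Now view the arcs as a graph with one vertex for each component and one for each suspension. If `E`
is the number of intersecting pairs, it has `l + m + E` vertices and `2E` edges, and it is connected
because `K` is. A spanning tree uses `l + m + E - 1` edges. Collapsing it joins all suspensions at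
the points `p e`, and each remaining edge becomes a circle, so there are `2E - (l + m + E - 1) = E -
l - m + 1` of them (`HCoeq.nonempty_equiv_wedge_circles`); being a number of edges, this is
nonnegative. The collapse is an equivalence because the contraction of the tree extends to the
suspensions: every point of a finite complex, hence of its suspension, is nondegenerate
(`IsNDRPoint`). -/

/-! ### Homotopies as maps into path spaces -/

section Paths

variable {X Y Z : Type*} [TopologicalSpace X] [TopologicalSpace Y] [TopologicalSpace Z]

/-- A homotopy equivalence from mutually inverse maps up to homotopies, the homotopies being given
as maps into path spaces. -/
theorem nonempty_homotopyEquiv_of_paths (f : C(X, Y)) (g : C(Y, X))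
    (HX : C(X, C(I, X))) (hX₀ : ∀ x, HX x 0 = x) (hX₁ : ∀ x, HX x 1 = g (f x))
    (HY : C(Y, C(I, Y))) (hY₀ : ∀ y, HY y 0 = y) (hY₁ : ∀ y, HY y 1 = f (g y)) :
    Nonempty (X ≃ₕ Y) := by
  refine ⟨⟨f, g, ?_, ?_⟩⟩
  · refine ContinuousMap.Homotopic.symm ⟨⟨⟨fun p => HX p.2 p.1, by fun_prop⟩, ?_, ?_⟩⟩
    · intro x; simp [hX₀]
    · intro x; simp [hX₁]
  · refine ContinuousMap.Homotopic.symm ⟨⟨⟨fun p => HY p.2 p.1, by fun_prop⟩, ?_, ?_⟩⟩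
    · intro x; simp [hY₀]
    · intro x; simp [hY₁]

/-- The map into the path space associated with a jointly continuous function. -/
def pathMap (F : X → I → Z) (hF : Continuous fun p : X × I => F p.1 p.2) : C(X, C(I, Z)) :=
  ContinuousMap.curry ⟨fun p : X × I => F p.1 p.2, hF⟩

@[simp] theorem pathMap_apply (F : X → I → Z) (hF : Continuous fun p : X × I => F p.1 p.2)
    (x : X) (t : I) : pathMap F hF x t = F x t := rfl

/-- The constant paths. -/
def constPaths (X : Type*) [TopologicalSpace X] : C(X, C(I, X)) :=
  pathMap (fun x _ => x) continuous_fst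

@[simp] theorem constPaths_apply (x : X) (t : I) : constPaths X x t = x := rfl

/-- The nearest point of the unit interval. -/
noncomputable def clampI (v : ℝ) : I := Set.projIcc 0 1 zero_le_one v

@[fun_prop] theorem continuous_clampI : Continuous clampI := continuous_projIcc (h := zero_le_one)

theorem clampI_of_nonpos {v : ℝ} (h : v ≤ 0) : clampI v = 0 := Set.projIcc_of_le_left _ h

theorem clampI_of_one_le {v : ℝ} (h : 1 ≤ v) : clampI v = 1 := Set.projIcc_of_right_le _ h

@[simp] theorem clampI_coe (s : I) : clampI s = s := Set.projIcc_val _ s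

@[simp] theorem clampI_zero : clampI 0 = 0 := clampI_of_nonpos le_rfl

@[simp] theorem clampI_one : clampI 1 = 1 := clampI_of_one_le le_rfl

theorem coe_clampI {v : ℝ} (h₀ : 0 ≤ v) (h₁ : v ≤ 1) : (clampI v : ℝ) = v := by
  simp [clampI, Set.coe_projIcc, h₀, h₁]

/-- The concatenation of the reverse of `α`, of `γ` and of `β`, parametrized by `[-1, 2]` and
extended to be constant outside. -/
noncomputable def ext3 (α γ β : I → Z) (v : ℝ) : Z :=
  if v ≤ 0 then α (clampI (-v)) else if v ≤ 1 then γ (clampI v) else β (clampI (v - 1))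

section ext3

variable {Z : Type*} {α γ β : I → Z}

theorem ext3_of_nonpos {v : ℝ} (h : v ≤ 0) : ext3 α γ β v = α (clampI (-v)) := if_pos h

theorem ext3_mid (h₀ : α 0 = γ 0) {v : ℝ} (hv₀ : 0 ≤ v) (hv₁ : v ≤ 1) :
    ext3 α γ β v = γ (clampI v) := by
  rcases hv₀.eq_or_lt with rfl | h
  · simp [ext3, h₀]
  · rw [ext3, if_neg h.not_ge, if_pos hv₁]

theorem ext3_coe (h₀ : α 0 = γ 0) (s : I) : ext3 α γ β s = γ s := by
  rw [ext3_mid h₀ s.2.1 s.2.2, clampI_coe]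

theorem ext3_of_one_le (h₁ : β 0 = γ 1) {v : ℝ} (hv : 1 ≤ v) :
    ext3 α γ β v = β (clampI (v - 1)) := by
  rcases hv.eq_or_lt with rfl | h
  · simp [ext3, h₁, not_le.2 (zero_lt_one' ℝ)]
  · rw [ext3, if_neg (by linarith), if_neg h.not_ge]

end ext3

/-- Most homotopies below are reparametrizations of such a three-piece path by an affine real
function `w`. Agreement at the junctions `0` and `1` glues the pieces. -/
theorem continuous_ext3 {α γ β : X → I → Z}
    (hα : Continuous fun p : X × I => α p.1 p.2) (hγ : Continuous fun p : X × I => γ p.1 p.2)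
    (hβ : Continuous fun p : X × I => β p.1 p.2) (h₀ : ∀ x, α x 0 = γ x 0)
    (h₁ : ∀ x, β x 0 = γ x 1) {w : X → ℝ} (hw : Continuous w) :
    Continuous fun x => ext3 (α x) (γ x) (β x) (w x) := by
  have key : ∀ {δ : X → I → Z}, (Continuous fun p : X × I => δ p.1 p.2) → ∀ {v : X → ℝ},
      Continuous v → Continuous fun x => δ x (clampI (v x)) := fun hδ v hv =>
    hδ.comp (continuous_id.prodMk (continuous_clampI.comp hv))
  refine Continuous.if_le (key hα hw.neg) ?_ hw continuous_const ?_
  · refine Continuous.if_le (key hγ hw) (key hβ (hw.sub continuous_const)) hw continuous_const ?_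
    intro x hx; simp [hx, h₁]
  · intro x hx; simp [hx, h₀]

end Paths

/-! ### Homotopy coequalizers -/

/-- The identifications defining the homotopy coequalizer. -/
inductive hcoeqRel {C B : Type*} (a b : C → B) : B ⊕ C × I → B ⊕ C × I → Prop
  | zero (c : C) : hcoeqRel a b (Sum.inr (c, 0)) (Sum.inl (a c))
  | one (c : C) : hcoeqRel a b (Sum.inr (c, 1)) (Sum.inl (b c))

/-- The homotopy coequalizer of two maps `a b : C → B`: the space `B` with a cylinder `C × [0,1]`
attached along its two ends by `a` and `b`. -/
def HCoeq {C B : Type*} (a b : C → B) : Type _ := Quot (hcoeqRel a b)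

namespace HCoeq

variable {C B Z : Type*} [TopologicalSpace C] [TopologicalSpace B] [TopologicalSpace Z]

instance (a b : C → B) : TopologicalSpace (HCoeq a b) :=
  inferInstanceAs (TopologicalSpace (Quot (hcoeqRel a b)))

instance (a b : C → B) [CompactSpace B] [CompactSpace C] : CompactSpace (HCoeq a b) :=
  inferInstanceAs (CompactSpace (Quot (hcoeqRel a b)))

/-- The inclusion of the base. -/
def base (a b : C → B) : C(B, HCoeq a b) :=
  ⟨fun x => Quot.mk _ (Sum.inl x), continuous_quot_mk.comp continuous_inl⟩

/-- The canonical map from the cylinder. -/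
def cyl (a b : C → B) : C(C × I, HCoeq a b) :=
  ⟨fun x => Quot.mk _ (Sum.inr x), continuous_quot_mk.comp continuous_inr⟩

variable {a b : C → B}

@[simp] theorem cyl_zero (c : C) : cyl a b (c, 0) = base a b (a c) :=
  Quot.sound (hcoeqRel.zero c)

@[simp] theorem cyl_one (c : C) : cyl a b (c, 1) = base a b (b c) :=
  Quot.sound (hcoeqRel.one c)

theorem ind {p : HCoeq a b → Prop} (hB : ∀ x, p (base a b x)) (hC : ∀ c s, p (cyl a b (c, s)))
    (x : HCoeq a b) : p x := by
  induction x using Quot.ind with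
  | mk x => rcases x with x | ⟨c, s⟩; exacts [hB x, hC c s]

/-- The universal property. -/
def lift (φ : C(B, Z)) (ψ : C(C × I, Z)) (h₀ : ∀ c, ψ (c, 0) = φ (a c))
    (h₁ : ∀ c, ψ (c, 1) = φ (b c)) : C(HCoeq a b, Z) where
  toFun := Quot.lift (Sum.elim φ ψ) (by rintro _ _ (c | c); exacts [h₀ c, h₁ c])
  continuous_toFun := continuous_quot_lift _ (continuous_sum_dom.2 ⟨φ.continuous, ψ.continuous⟩)

@[simp] theorem lift_base (φ : C(B, Z)) (ψ : C(C × I, Z)) (h₀ : ∀ c, ψ (c, 0) = φ (a c))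
    (h₁ : ∀ c, ψ (c, 1) = φ (b c)) (x : B) : lift φ ψ h₀ h₁ (base a b x) = φ x := rfl

@[simp] theorem lift_cyl (φ : C(B, Z)) (ψ : C(C × I, Z)) (h₀ : ∀ c, ψ (c, 0) = φ (a c))
    (h₁ : ∀ c, ψ (c, 1) = φ (b c)) (x : C × I) : lift φ ψ h₀ h₁ (cyl a b x) = ψ x := rfl

theorem nonempty_equiv_of_eq {a' b' : C → B} (ha : ∀ c, a c = a' c) (hb : ∀ c, b c = b' c) :
    Nonempty (HCoeq a b ≃ₕ HCoeq a' b') := by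
  obtain rfl := funext ha
  obtain rfl := funext hb
  exact ⟨.refl _⟩

theorem nonempty_equiv_comp_homeomorph {C' : Type*} [TopologicalSpace C'] (e : C' ≃ₜ C) :
    Nonempty (HCoeq (fun c => a (e c)) (fun c => b (e c)) ≃ₕ HCoeq a b) := by
  refine nonempty_homotopyEquiv_of_paths
    (lift (base a b) ⟨fun p => cyl a b (e p.1, p.2), by fun_prop⟩ (by simp) (by simp))
    (lift (base _ _) ⟨fun p => cyl _ _ (e.symm p.1, p.2), by fun_prop⟩ (by simp) (by simp))
    (constPaths _) (fun _ => rfl) ?_ (constPaths _) (fun _ => rfl) ?_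
  · exact ind (by simp) (by simp)
  · exact ind (by simp) (by simp)

/-- The homotopy coequalizer of two homotopies deforms to the one of their initial maps. -/
theorem nonempty_equiv_initial (α β : C(C, C(I, B))) :
    Nonempty (HCoeq (fun p : C × I => α p.1 p.2) (fun p : C × I => β p.1 p.2) ≃ₕ
      HCoeq (fun c => α c 0) (fun c => β c 0)) := by
  set a₀ : C → B := fun c => α c 0
  set b₀ : C → B := fun c => β c 0
  set a₁ : C × I → B := fun p => α p.1 p.2
  set b₁ : C × I → B := fun p => β p.1 p.2
  -- At height `t` of the strip, `w` maps `[0,1]` affinely onto `[-t, 1 + t]`. So `Γ` runs back from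
  -- `α c t` to `α c 0`, across the cylinder, and out to `β c t`.
  let w : (C × I) × I → ℝ := fun p => p.2 + p.1.2 * (2 * p.2 - 1)
  have hw : Continuous w := by fun_prop
  let Γ : (C × I) × I → HCoeq a₀ b₀ := fun p =>
    ext3 (fun x => base a₀ b₀ (α p.1.1 x)) (fun x => cyl a₀ b₀ (p.1.1, x))
      (fun x => base a₀ b₀ (β p.1.1 x)) (w p)
  have h₀ : ∀ c : C, base a₀ b₀ (α c 0) = cyl a₀ b₀ (c, 0) := fun c => by simp [a₀]
  have h₁ : ∀ c : C, base a₀ b₀ (β c 0) = cyl a₀ b₀ (c, 1) := fun c => by simp [b₀]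
  have hΓ : Continuous Γ := continuous_ext3 (by fun_prop) (by fun_prop) (by fun_prop)
    (fun p => h₀ p.1.1) (fun p => h₁ p.1.1) hw
  -- `(τ, u)` is the straight-line homotopy in the square from the identity to a retraction onto the
  -- bottom edge and the two sides. It fixes the sides, so it is compatible with the gluing.
  let τ : ((C × I) × I) × I → ℝ := fun q =>
    (1 - q.2) * q.1.1.2 + q.2 * max 0 (max (-w q.1) (w q.1 - 1))
  let u : ((C × I) × I) × I → ℝ := fun q => (1 - q.2) * q.1.2 + q.2 * (clampI (w q.1) : ℝ)
  have hτ : Continuous τ := by fun_prop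
  have hu : Continuous u := by fun_prop
  have hw₀ : ∀ p : C × I, w (p, 0) = -p.2 := fun p => by simp [w]
  have hw₁ : ∀ p : C × I, w (p, 1) = 1 + p.2 := fun p => by simp [w]; norm_num
  refine nonempty_homotopyEquiv_of_paths
    (lift (base a₀ b₀) ⟨Γ, hΓ⟩ (fun p => ?_) (fun p => ?_))
    (lift (base a₁ b₁) ⟨fun p => cyl a₁ b₁ ((p.1, 0), p.2), by fun_prop⟩ (by simp [a₀, a₁])
      (by simp [b₀, b₁]))
    (lift (pathMap (fun x _ => base a₁ b₁ x) (by fun_prop))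
      (pathMap (fun p t => cyl a₁ b₁ ((p.1.1, clampI (τ (p, t))), clampI (u (p, t))))
        (by fun_prop)) (fun p => ?_) (fun p => ?_)) (ind (by simp) fun p s => ?_)
    (ind (by simp) fun p s => ?_) (constPaths _) (fun _ => rfl) (ind (by simp) fun c s => ?_)
  · have : w (p, 0) ≤ 0 := by rw [hw₀]; have := p.2.2.1; linarith
    simp only [ContinuousMap.coe_mk, Γ]
    rw [ext3_of_nonpos this, hw₀, neg_neg, clampI_coe]
  · have : 1 ≤ w (p, 1) := by rw [hw₁]; have := p.2.2.1; linarith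
    simp only [ContinuousMap.coe_mk, Γ]
    rw [ext3_of_one_le (h₁ _) this, hw₁, add_sub_cancel_left, clampI_coe]
  · ext t
    have hp := p.2.2.1
    have e₁ : u ((p, 0), t) = 0 := by
      simp only [u, hw₀]; rw [clampI_of_nonpos (by linarith)]; simp
    have e₂ : τ ((p, 0), t) = p.2 := by
      simp only [τ, hw₀]
      rw [neg_neg, max_eq_left (b := -(p.2 : ℝ) - 1) (by linarith), max_eq_right hp]; ring
    simp only [pathMap_apply, e₁, e₂, clampI_coe, clampI_zero, cyl_zero, a₁]
  · ext t
    have hp := p.2.2.1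
    have e₁ : u ((p, 1), t) = 1 := by
      simp only [u, hw₁]; rw [clampI_of_one_le (by linarith)]; simp
    have e₂ : τ ((p, 1), t) = p.2 := by
      simp only [τ, hw₁]
      rw [add_sub_cancel_left, max_eq_right (a := -(1 + (p.2 : ℝ))) (by linarith),
        max_eq_right hp]; ring
    simp only [pathMap_apply, e₁, e₂, clampI_coe, clampI_one, cyl_one, b₁]
  · have e₁ : u ((p, s), 0) = s := by simp [u]
    have e₂ : τ ((p, s), 0) = p.2 := by simp [τ]
    simp only [lift_cyl, pathMap_apply, e₁, e₂, clampI_coe]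
  · have e₁ : u ((p, s), 1) = clampI (w (p, s)) := by simp [u]
    have e₂ : τ ((p, s), 1) = max 0 (max (-w (p, s)) (w (p, s) - 1)) := by simp [τ]
    simp only [lift_cyl, pathMap_apply, e₁, e₂, clampI_coe, ContinuousMap.coe_mk, Γ]
    rcases le_total (w (p, s)) 0 with hv | hv
    · rw [ext3_of_nonpos hv, lift_base, clampI_of_nonpos hv,
        max_eq_left (b := w (p, s) - 1) (by linarith), max_eq_right (by linarith), cyl_zero]
    rcases le_total (w (p, s)) 1 with hv' | hv'
    · rw [ext3_mid (h₀ _) hv hv', lift_cyl, max_eq_left (max_le (by linarith) (by linarith)),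
        clampI_zero]
      rfl
    · rw [ext3_of_one_le (h₁ _) hv', lift_base, clampI_of_one_le hv',
        max_eq_right (b := w (p, s) - 1) (by linarith), max_eq_right (by linarith), cyl_one]
  · have e : w ((c, 0), s) = s := by simp [w]
    simp only [lift_cyl, constPaths_apply, ContinuousMap.coe_mk, Γ, e]
    rw [ext3_coe (h₀ _)]

/-- Homotopic attaching maps give homotopy equivalent homotopy coequalizers. -/
theorem nonempty_equiv_of_homotopy (α β : C(C, C(I, B))) :
    Nonempty (HCoeq (fun c => α c 0) (fun c => β c 0) ≃ₕ
      HCoeq (fun c => α c 1) (fun c => β c 1)) := by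
  obtain ⟨e₀⟩ := nonempty_equiv_initial α β
  -- The strip over `C × I` deforms to its final edge as well: reverse time in both homotopies. Both
  -- edges are thus compared with the same strip, up to the flip of `I`.
  obtain ⟨e₁⟩ := nonempty_equiv_initial
    (pathMap (fun c t => α c (σ t)) (by fun_prop)) (pathMap (fun c t => β c (σ t)) (by fun_prop))
  obtain ⟨e₂⟩ := nonempty_equiv_comp_homeomorph (a := fun p : C × I => α p.1 p.2)
    (b := fun p : C × I => β p.1 p.2) ((Homeomorph.refl C).prodCongr unitInterval.symmHomeomorph)
  obtain ⟨e₃⟩ := nonempty_equiv_of_eq (a := fun c => α c (σ 0)) (a' := fun c => α c 1)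
    (b := fun c => β c (σ 0)) (b' := fun c => β c 1) (by simp) (by simp)
  exact ⟨e₀.symm.trans (e₂.symm.trans (e₁.trans e₃))⟩

end HCoeq

/-! ### Suspensions -/

namespace Suspension

variable {X Z : Type*} [TopologicalSpace X] [TopologicalSpace Z]

/-- The quotient map onto the suspension. -/
def mk (X : Type*) [TopologicalSpace X] : C(X × I, Suspension X) :=
  ⟨Quot.mk _, continuous_quot_mk⟩

theorem mk_zero (x y : X) : mk X (x, 0) = mk X (y, 0) := Quot.sound (Or.inl ⟨rfl, rfl⟩)

theorem mk_one (x y : X) : mk X (x, 1) = mk X (y, 1) := Quot.sound (Or.inr ⟨rfl, rfl⟩)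

theorem ind {p : Suspension X → Prop} (h : ∀ x s, p (mk X (x, s))) (y : Suspension X) : p y := by
  induction y using Quot.ind with
  | mk y => exact h y.1 y.2

/-- The universal property of the suspension. -/
def lift (F : C(X × I, Z)) (h₀ : ∀ x y, F (x, 0) = F (y, 0)) (h₁ : ∀ x y, F (x, 1) = F (y, 1)) :
    C(Suspension X, Z) where
  toFun := Quot.lift F (by
    rintro ⟨x, s⟩ ⟨y, t⟩ (⟨rfl, rfl⟩ | ⟨rfl, rfl⟩)
    exacts [h₀ x y, h₁ x y])
  continuous_toFun := continuous_quot_lift _ F.continuous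

@[simp] theorem lift_mk (F : C(X × I, Z)) (h₀ : ∀ x y, F (x, 0) = F (y, 0))
    (h₁ : ∀ x y, F (x, 1) = F (y, 1)) (p : X × I) : lift F h₀ h₁ (mk X p) = F p := rfl

end Suspension

/-! ### Contracting the base of a homotopy coequalizer -/

/-- The map out of a disjoint union with given restrictions. -/
def sigmaMap {E Z : Type*} {C : E → Type*} [∀ e, TopologicalSpace (C e)] [TopologicalSpace Z]
    (φ : ∀ e, C(C e, Z)) : C((Σ e, C e), Z) :=
  ⟨fun c => φ c.1 c.2, continuous_sigma fun e => (φ e).continuous⟩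

@[simp] theorem sigmaMap_mk {E Z : Type*} {C : E → Type*} [∀ e, TopologicalSpace (C e)]
    [TopologicalSpace Z] (φ : ∀ e, C(C e, Z)) (e : E) (c : C e) : sigmaMap φ ⟨e, c⟩ = φ e c := rfl

/-- The map out of a binary disjoint union with given restrictions. -/
def sumMap {A B Z : Type*} [TopologicalSpace A] [TopologicalSpace B] [TopologicalSpace Z]
    (φ : C(A, Z)) (ψ : C(B, Z)) : C(A ⊕ B, Z) :=
  ⟨Sum.elim φ ψ, continuous_sum_dom.2 ⟨φ.continuous, ψ.continuous⟩⟩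

@[simp] theorem sumMap_inl {A B Z : Type*} [TopologicalSpace A] [TopologicalSpace B]
    [TopologicalSpace Z] (φ : C(A, Z)) (ψ : C(B, Z)) (x : A) :
    sumMap φ ψ (Sum.inl x) = φ x := rfl

@[simp] theorem sumMap_inr {A B Z : Type*} [TopologicalSpace A] [TopologicalSpace B]
    [TopologicalSpace Z] (φ : C(A, Z)) (ψ : C(B, Z)) (x : B) :
    sumMap φ ψ (Sum.inr x) = ψ x := rfl

namespace HCoeq

/-- If the base of a homotopy coequalizer contracts to a space `W` of points and the attached space
is the disjoint union of the `C e`, each attached to one point of `W` at either end, then the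
homotopy coequalizer is equivalent to the union of `W` and of the suspensions of the `C e`,
connected by arcs from the poles to the corresponding points. -/
theorem nonempty_equiv_suspensionGraph {B W E : Type*} {C : E → Type*} [TopologicalSpace B]
    [TopologicalSpace W] [TopologicalSpace E] [DiscreteTopology E] [∀ e, TopologicalSpace (C e)]
    (a b : C((Σ e, C e), B)) (π : C(B, W)) (ρ : C(W, B)) (κ : C(B, C(I, B)))
    (hκ₀ : ∀ x, κ x 0 = x) (hκ₁ : ∀ x, κ x 1 = ρ (π x)) (hπκ : ∀ x t, π (κ x t) = π x)
    (hπρ : ∀ w, π (ρ w) = w) (α β : E → W) (hα : ∀ c, π (a c) = α c.1)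
    (hβ : ∀ c, π (b c) = β c.1) (c₀ : ∀ e, C e) :
    Nonempty (HCoeq a b ≃ₕ
      HCoeq (C := E ⊕ E) (B := W ⊕ Σ e, Suspension (C e))
        (Sum.elim (fun e => Sum.inr ⟨e, Suspension.mk _ (c₀ e, 0)⟩)
          (fun e => Sum.inr ⟨e, Suspension.mk _ (c₀ e, 1)⟩))
        (Sum.elim (fun e => Sum.inl (α e)) (fun e => Sum.inl (β e)))) := by
  set a' : E ⊕ E → W ⊕ Σ e, Suspension (C e) := Sum.elim
    (fun e => Sum.inr ⟨e, Suspension.mk _ (c₀ e, 0)⟩)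
    (fun e => Sum.inr ⟨e, Suspension.mk _ (c₀ e, 1)⟩) with ha'
  set b' : E ⊕ E → W ⊕ Σ e, Suspension (C e) := Sum.elim
    (fun e => Sum.inl (α e)) (fun e => Sum.inl (β e)) with hb'
  have hfst : Continuous (Sigma.fst : (Σ e, C e) → E) := continuous_sigma fun _ => continuous_const
  let S : C((Σ e, C e), C(I, HCoeq a' b')) := sigmaMap fun e =>
    pathMap (fun c s => base a' b' (Sum.inr ⟨e, Suspension.mk _ (c, s)⟩))
      ((base a' b').continuous.comp (continuous_inr.comp
        (continuous_sigmaMk.comp (Suspension.mk (C e)).continuous)))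
  have hS : ∀ e c s, S ⟨e, c⟩ s = base a' b' (Sum.inr ⟨e, Suspension.mk _ (c, s)⟩) :=
    fun _ _ _ => rfl
  have hS₀ : ∀ c, cyl a' b' (Sum.inl c.1, 0) = S c 0 := fun c => by
    rw [cyl_zero]; exact congrArg (fun x => base a' b' (Sum.inr ⟨c.1, x⟩)) (Suspension.mk_zero _ _)
  have hS₁ : ∀ c, cyl a' b' (Sum.inr c.1, 0) = S c 1 := fun c => by
    rw [cyl_zero]; exact congrArg (fun x => base a' b' (Sum.inr ⟨c.1, x⟩)) (Suspension.mk_one _ _)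
  -- Over `[-1, 2]`, `Γ` follows a cylinder line prolonged at both ends by the tracks of the
  -- contraction `κ`; `Δ` below follows a meridian prolonged by the two arcs. Beyond that range both
  -- are constant.
  let Γ : (Σ e, C e) × ℝ → HCoeq a b := fun p => ext3 (fun x => base a b (κ (a p.1) x))
    (fun x => cyl a b (p.1, x)) (fun x => base a b (κ (b p.1) x)) p.2
  have hΓ₀ : ∀ c, base a b (κ (a c) 0) = cyl a b (c, 0) := fun c => by simp [hκ₀]
  have hΓ₁ : ∀ c, base a b (κ (b c) 0) = cyl a b (c, 1) := fun c => by simp [hκ₀]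
  have hΓ : Continuous Γ := continuous_ext3 (by fun_prop) (by fun_prop) (by fun_prop)
    (fun p => hΓ₀ p.1) (fun p => hΓ₁ p.1) continuous_snd
  let Δ : (Σ e, C e) × ℝ → HCoeq a' b' := fun p => ext3 (fun x => cyl a' b' (Sum.inl p.1.1, x))
    (fun x => S p.1 x) (fun x => cyl a' b' (Sum.inr p.1.1, x)) p.2
  have hΔ : Continuous Δ := continuous_ext3 (by fun_prop) (by fun_prop) (by fun_prop)
    (fun p => hS₀ p.1) (fun p => hS₁ p.1) continuous_snd
  have Γ_lo : ∀ c v, v ≤ -1 → Γ (c, v) = base a b (ρ (α c.1)) := fun c v hv => by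
    simp only [Γ]; rw [ext3_of_nonpos (by linarith), clampI_of_one_le (by linarith), hκ₁, hα]
  have Γ_hi : ∀ c v, 2 ≤ v → Γ (c, v) = base a b (ρ (β c.1)) := fun c v hv => by
    simp only [Γ]
    rw [ext3_of_one_le (hΓ₁ c) (by linarith), clampI_of_one_le (by linarith), hκ₁, hβ]
  have Γ_coe : ∀ c (s : I), Γ (c, s) = cyl a b (c, s) := fun c s => ext3_coe (hΓ₀ c) s
  have Γ_neg : ∀ c v, v ≤ 0 → Γ (c, v) = base a b (κ (a c) (clampI (-v))) := fun c v hv =>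
    ext3_of_nonpos hv
  have Γ_pos : ∀ c v, 1 ≤ v → Γ (c, v) = base a b (κ (b c) (clampI (v - 1))) := fun c v hv =>
    ext3_of_one_le (hΓ₁ c) hv
  have Δ_coe : ∀ c (s : I), Δ (c, s) = S c s := fun c s => ext3_coe (hS₀ c) s
  have Δ_neg : ∀ c v, v ≤ 0 → Δ (c, v) = cyl a' b' (Sum.inl c.1, clampI (-v)) := fun c v hv =>
    ext3_of_nonpos hv
  have Δ_pos : ∀ c v, 1 ≤ v → Δ (c, v) = cyl a' b' (Sum.inr c.1, clampI (v - 1)) := fun c v hv =>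
    ext3_of_one_le (hS₁ c) hv
  have Δ_lo : ∀ c v, v ≤ -1 → Δ (c, v) = base a' b' (Sum.inl (α c.1)) := fun c v hv => by
    rw [Δ_neg _ _ (by linarith), clampI_of_one_le (by linarith), cyl_one]; rfl
  have Δ_hi : ∀ c v, 2 ≤ v → Δ (c, v) = base a' b' (Sum.inl (β c.1)) := fun c v hv => by
    rw [Δ_pos _ _ (by linarith), clampI_of_one_le (by linarith), cyl_one]; rfl
  -- The substitution `3s - 1` stretches `[0,1]` onto `[-1,2]`. `f` spreads each cylinder line over
  -- arc, meridian, arc; `g` spreads each meridian over track, line, track and is constant on the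
  -- arcs.
  let f : C(HCoeq a b, HCoeq a' b') := lift
    ⟨fun x => base a' b' (Sum.inl (π x)), by fun_prop⟩
    ⟨fun p => Δ (p.1, 3 * p.2 - 1), by fun_prop⟩
    (fun c => by simp only [ContinuousMap.coe_mk]; rw [Δ_lo _ _ (by simp), hα])
    (fun c => by simp only [ContinuousMap.coe_mk]; rw [Δ_hi _ _ (by norm_num), hβ])
  let gS : ∀ e, C(Suspension (C e), HCoeq a b) := fun e => Suspension.lift
    ⟨fun p => Γ (⟨e, p.1⟩, 3 * p.2 - 1), by fun_prop⟩
    (fun c d => by simp only [ContinuousMap.coe_mk]; rw [Γ_lo _ _ (by simp), Γ_lo _ _ (by simp)])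
    (fun c d => by
      simp only [ContinuousMap.coe_mk]; rw [Γ_hi _ _ (by norm_num), Γ_hi _ _ (by norm_num)])
  let g : C(HCoeq a' b', HCoeq a b) := lift
    (sumMap ((base a b).comp ρ) (sigmaMap gS))
    ⟨fun p => Sum.elim (fun e => base a b (ρ (α e))) (fun e => base a b (ρ (β e))) p.1,
      (continuous_of_discreteTopology (f := Sum.elim (fun e => base a b (ρ (α e)))
        (fun e => base a b (ρ (β e))))).comp continuous_fst⟩
    (by
      rintro (e | e)
      · exact (Γ_lo ⟨e, c₀ e⟩ _ (by simp)).symm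
      · exact (Γ_hi ⟨e, c₀ e⟩ _ (by norm_num)).symm)
    (by rintro (e | e) <;> rfl)
  have hf : ∀ c v, f (Γ (c, v)) = Δ (c, 3 * v - 1) := by
    intro c v
    rcases le_total v 0 with hv | hv
    · rw [Γ_neg _ _ hv, Δ_lo _ _ (by linarith)]
      exact congrArg (fun x => base a' b' (Sum.inl x)) ((hπκ _ _).trans (hα c))
    rcases le_total v 1 with hv' | hv'
    · rw [← coe_clampI hv hv', Γ_coe]; rfl
    · rw [Γ_pos _ _ hv', Δ_hi _ _ (by linarith)]
      exact congrArg (fun x => base a' b' (Sum.inl x)) ((hπκ _ _).trans (hβ c))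
  have hg : ∀ c v, g (Δ (c, v)) = Γ (c, 3 * v - 1) := by
    intro c v
    rcases le_total v 0 with hv | hv
    · rw [Δ_neg _ _ hv, Γ_lo _ _ (by linarith)]; rfl
    rcases le_total v 1 with hv' | hv'
    · rw [← coe_clampI hv hv', Δ_coe]; rfl
    · rw [Δ_pos _ _ hv', Γ_hi _ _ (by linarith)]; rfl
  -- Both composites reparametrize by `3(3s - 1) - 1 = 9s - 4`; `w` interpolates linearly between
  -- this and `s`. The ends move to `-4t` and `1 + 4t`, hence the speed `4` in the homotopies on the
  -- base and on the arcs.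
  let w : I × I → ℝ := fun p => p.1 + p.2 * (8 * p.1 - 4)
  have w₀ : ∀ t : I, w (0, t) = -(4 * t) := fun t => by simp [w]; ring
  have w₁ : ∀ t : I, w (1, t) = 1 + 4 * t := fun t => by simp [w]; ring
  have wi : ∀ s : I, w (s, 0) = s := fun s => by simp [w]
  have we : ∀ s : I, w (s, 1) = 3 * (3 * s - 1) - 1 := fun s => by simp [w]; ring
  have hw : Continuous w := by fun_prop
  refine nonempty_homotopyEquiv_of_paths f g
    (lift (pathMap (fun x t => base a b (κ x (clampI (4 * t)))) (by fun_prop))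
      (pathMap (fun p t => Γ (p.1, w (p.2, t))) (by fun_prop)) (fun c => ?_) fun c => ?_)
    (ind (fun x => ?_) fun c s => ?_) (ind (fun x => ?_) fun c s => ?_)
    (lift (sumMap (pathMap (fun x t => base a' b' (Sum.inl x)) (by fun_prop))
        (sigmaMap fun e => Suspension.lift
          (pathMap (fun p t => Δ (⟨e, p.1⟩, w (p.2, t))) (by fun_prop))
          (fun c d => ?_) fun c d => ?_))
      (pathMap (fun p t => cyl a' b' (p.1, clampI (p.2 + 4 * t))) (by fun_prop))
      ?_ ?_) (ind (fun x => ?_) fun c s => ?_) (ind (fun x => ?_) fun c s => ?_)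
  · ext t
    have := t.2.1
    simp only [pathMap_apply]
    rw [w₀, Γ_neg _ _ (by linarith), neg_neg]
  · ext t
    have := t.2.1
    simp only [pathMap_apply]
    rw [w₁, Γ_pos _ _ (by linarith), add_sub_cancel_left]
  · simp [hκ₀]
  · simp only [lift_cyl, pathMap_apply]
    rw [wi, Γ_coe]
  · simp only [lift_base, pathMap_apply]
    rw [clampI_of_one_le (by norm_num), hκ₁]
    rfl
  · simp only [lift_cyl, pathMap_apply]
    rw [we, ← hg]
    rfl
  · ext t
    have := t.2.1
    simp only [pathMap_apply]
    rw [w₀, Δ_neg _ _ (by linarith), Δ_neg _ _ (by linarith)]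
  · ext t
    have := t.2.1
    simp only [pathMap_apply]
    rw [w₁, Δ_pos _ _ (by linarith), Δ_pos _ _ (by linarith)]
  · rintro (e | e)
    · ext t
      have := t.2.1
      simp only [pathMap_apply, ha', Sum.elim_inl, sumMap_inr, sigmaMap_mk, Suspension.lift_mk]
      rw [w₀, Δ_neg _ _ (by linarith)]
      simp
    · ext t
      have := t.2.1
      simp only [pathMap_apply, ha', Sum.elim_inr, sumMap_inr, sigmaMap_mk, Suspension.lift_mk]
      rw [w₁, Δ_pos _ _ (by linarith)]
      simp
  · have : ∀ t : I, clampI (1 + 4 * t) = 1 := fun t =>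
      clampI_of_one_le (by have := t.2.1; linarith)
    rintro (e | e) <;> ext t <;> simp [this, hb']
  · rcases x with x | ⟨e, x⟩
    · rfl
    · induction x using Suspension.ind with
      | h c s =>
        simp only [lift_base, sumMap_inr, sigmaMap_mk, Suspension.lift_mk, pathMap_apply]
        rw [wi, Δ_coe, hS]
  · simp
  · rcases x with x | ⟨e, x⟩
    · exact congrArg (fun x => base a' b' (Sum.inl x)) (hπρ x).symm
    · induction x using Suspension.ind with
      | h c s =>
        simp only [lift_base, sumMap_inr, sigmaMap_mk, Suspension.lift_mk, pathMap_apply]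
        rw [we, ← hf]
        rfl
  · simp only [lift_cyl, pathMap_apply]
    rw [clampI_of_one_le (by have := s.2.1; norm_num; linarith), cyl_one]
    rcases c with e | e
    · exact congrArg (fun x => base a' b' (Sum.inl x)) (hπρ (α e)).symm
    · exact congrArg (fun x => base a' b' (Sum.inl x)) (hπρ (β e)).symm

end HCoeq

/-! ### Contracting a spanning tree -/

section Tree

variable {P J A : Type*} [TopologicalSpace A]

/-- In a connected graph with a root, every other vertex is joined by an edge to a vertex of depth
one less. -/
theorem exists_depth (s t : J → P) (v₀ : P)
    (hconn : ∀ g : P → Prop, (∀ j, g (s j) ↔ g (t j)) → g v₀ → ∀ v, g v) :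
    ∃ d : P → ℕ, d v₀ = 0 ∧ ∀ v, v ≠ v₀ → ∃ (j : J) (u : P), d v = d u + 1 ∧
      ((s j = v ∧ t j = u) ∨ (s j = u ∧ t j = v)) := by
  classical
  -- `R n v` says that a walk of `n` edges joins `v` to the root. Reachability is invariant along
  -- edges, so `hconn` makes it universal, and the depth is the least such `n`.
  let R : ℕ → P → Prop := fun n => Nat.rec (motive := fun _ => P → Prop) (fun v => v = v₀)
    (fun _ r v => ∃ j u, r u ∧ ((s j = v ∧ t j = u) ∨ (s j = u ∧ t j = v))) n
  have hR : ∀ v, ∃ n, R n v := by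
    refine hconn _ (fun j => ⟨fun ⟨n, hn⟩ => ?_, fun ⟨n, hn⟩ => ?_⟩) ⟨0, rfl⟩
    · exact ⟨n + 1, j, s j, hn, Or.inr ⟨rfl, rfl⟩⟩
    · exact ⟨n + 1, j, t j, hn, Or.inl ⟨rfl, rfl⟩⟩
  let d : P → ℕ := fun v => Nat.find (hR v)
  refine ⟨d, (Nat.find_eq_zero (hR v₀)).2 rfl, fun v hv => ?_⟩
  have h : R (d v) v := Nat.find_spec (hR v)
  obtain ⟨k, hk⟩ : ∃ k, d v = k + 1 := by
    refine Nat.exists_eq_succ_of_ne_zero fun h0 => hv ?_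
    rw [h0] at h; exact h
  rw [hk] at h
  obtain ⟨j, u, hu, hj⟩ := h
  refine ⟨j, u, ?_, hj⟩
  have h₁ : d u ≤ k := Nat.find_le hu
  have h₂ : d v ≤ d u + 1 :=
    Nat.find_le ⟨j, u, Nat.find_spec (hR u), hj⟩
  omega

/-- A connected graph of arcs in a space contains a spanning tree, which contracts to its root
within itself. -/
theorem exists_tree_contraction [Finite P] (pt : P → A) (arc : J → C(I, A)) (s t : J → P)
    (h₀ : ∀ j, arc j 0 = pt (s j)) (h₁ : ∀ j, arc j 1 = pt (t j)) (v₀ : P)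
    (hconn : ∀ g : P → Prop, (∀ j, g (s j) ↔ g (t j)) → g v₀ → ∀ v, g v) :
    ∃ (T : Set J) (θ : P → C(I, A)), Nat.card T + 1 = Nat.card P ∧
      (∀ v, θ v 0 = pt v) ∧ (∀ v, θ v 1 = pt v₀) ∧
      (∀ v x, (∃ w, θ v x = pt w) ∨ ∃ j ∈ T, ∃ u, θ v x = arc j u) ∧
      ∀ j ∈ T, ∃ η : C(I, C(I, A)), η 0 = θ (s j) ∧ η 1 = θ (t j) ∧
        (∀ u, η u 0 = arc j u) ∧ ∀ u, η u 1 = pt v₀ := by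
  classical
  obtain ⟨d, hd₀, hd⟩ := exists_depth s t v₀ hconn
  -- Without arcs there is only the root; this case is separate because choosing `jj` as a total
  -- function needs a default arc.
  rcases isEmpty_or_nonempty J with _ | _
  · have hP : ∀ v, v = v₀ := fun v => by_contra fun h => isEmptyElim (hd v h).choose
    have : Unique P := ⟨⟨v₀⟩, hP⟩
    exact ⟨∅, fun v => .const I (pt v), by simp, fun _ => rfl, fun v => congrArg pt (hP v),
      fun v _ => Or.inl ⟨v, rfl⟩, by simp⟩
  choose! jj par hdp hjj using hd
  let τ : P → I → A := fun v u => arc (jj v) (if s (jj v) = v then u else σ u)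
  have hτc : ∀ v, Continuous (τ v) := fun v => by
    by_cases h : s (jj v) = v
    · simp only [τ, if_pos h]; fun_prop
    · simp only [τ, if_neg h]; fun_prop
  have hne : ∀ v, v ≠ v₀ → par v ≠ v := fun v hv h => by
    have := hdp v hv; rw [h] at this; omega
  have hτ₀ : ∀ v, v ≠ v₀ → τ v 0 = pt v := fun v hv => by
    rcases hjj v hv with ⟨h, -⟩ | ⟨h, h'⟩
    · change arc (jj v) (if s (jj v) = v then 0 else σ 0) = _
      rw [if_pos h, h₀, h]
    · change arc (jj v) (if s (jj v) = v then 0 else σ 0) = _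
      rw [if_neg (h.trans_ne (hne v hv)), unitInterval.symm_zero, h₁, h']
  have hτ₁ : ∀ v, v ≠ v₀ → τ v 1 = pt (par v) := fun v hv => by
    rcases hjj v hv with ⟨h, h'⟩ | ⟨h, h'⟩
    · change arc (jj v) (if s (jj v) = v then 1 else σ 1) = _
      rw [if_pos h, h₁, h']
    · change arc (jj v) (if s (jj v) = v then 1 else σ 1) = _
      rw [if_neg (h.trans_ne (hne v hv)), unitInterval.symm_one, h₀, h]
  -- `γ v` below walks from `v` through successive parents to the root, one arc per unit of time,
  -- then rests there. The index of `G` is the depth on which the recursion runs.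
  let G : ℕ → P → ℝ → A := fun n => Nat.rec (fun v _ => pt v)
    (fun _ r v z => if z ≤ 1 then τ v (clampI z) else r (par v) (z - 1)) n
  have hGs : ∀ n v z, G (n + 1) v z = if z ≤ 1 then τ v (clampI z) else G n (par v) (z - 1) :=
    fun _ _ _ => rfl
  let γ : P → ℝ → A := fun v => G (d v) v
  have hγr : ∀ z, γ v₀ z = pt v₀ := fun z => by simp only [γ, hd₀]; rfl
  have hγs : ∀ v, v ≠ v₀ → ∀ z, γ v z = if z ≤ 1 then τ v (clampI z) else γ (par v) (z - 1) :=
    fun v hv z => by simp only [γ]; rw [hdp v hv, hGs]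
  have hγ₀ : ∀ v z, z ≤ 0 → γ v z = pt v := fun v z hz => by
    by_cases hv : v = v₀
    · rw [hv, hγr]
    · rw [hγs v hv, if_pos (by linarith), clampI_of_nonpos hz, hτ₀ v hv]
  have hγ_add : ∀ v, v ≠ v₀ → ∀ z, 0 ≤ z → γ v (1 + z) = γ (par v) z := fun v hv z hz => by
    rw [hγs v hv]
    split_ifs with h
    · obtain rfl : z = 0 := by linarith
      rw [hγ₀ _ _ le_rfl, add_zero, clampI_one, hτ₁ v hv]
    · rw [add_sub_cancel_left]
  have hind : ∀ (p : P → Prop), p v₀ → (∀ v, v ≠ v₀ → p (par v) → p v) → ∀ v, p v := by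
    intro p hp₀ hp
    suffices ∀ n v, d v = n → p v from fun v => this _ v rfl
    intro n
    induction n with
    | zero =>
      intro v hv
      by_cases h : v = v₀
      · exact h ▸ hp₀
      · have := hdp v h; omega
    | succ n ih =>
      intro v hv
      by_cases h : v = v₀
      · exact h ▸ hp₀
      · exact hp v h (ih _ (by have := hdp v h; omega))
  have hγc : ∀ v, Continuous (γ v) := by
    refine hind _ ?_ fun v hv ih => ?_
    · rw [funext hγr]; exact continuous_const
    · rw [funext (hγs v hv)]
      refine Continuous.if_le ((hτc v).comp continuous_clampI) (ih.comp (by fun_prop))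
        continuous_id continuous_const ?_
      rintro z rfl
      rw [clampI_one, hτ₁ v hv, sub_self, hγ₀ _ _ le_rfl]
  have hγ₁ : ∀ v z, (d v : ℝ) ≤ z → γ v z = pt v₀ := by
    refine hind _ (fun z _ => hγr z) fun v hv ih z hz => ?_
    rw [hdp v hv, Nat.cast_add, Nat.cast_one] at hz
    have := hγ_add v hv (z - 1) (by have := (d (par v)).cast_nonneg (α := ℝ); linarith)
    rw [show 1 + (z - 1) = z by ring] at this
    rw [this, ih _ (by linarith)]
  let T : Set J := {j | ∃ v, v ≠ v₀ ∧ jj v = j}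
  have hγT : ∀ v z, (∃ w, γ v z = pt w) ∨ ∃ j ∈ T, ∃ u, γ v z = arc j u := by
    refine hind _ (fun z => Or.inl ⟨v₀, hγr z⟩) fun v hv ih z => ?_
    rw [hγs v hv]
    split_ifs
    · exact Or.inr ⟨jj v, ⟨v, hv, rfl⟩, _, rfl⟩
    · exact ih _
  -- A common speed `N` for all vertices lets the motion of a tree arc match that of its endpoints.
  obtain ⟨N, hN⟩ := (Set.finite_range d).bddAbove
  have hN : ∀ v, (d v : ℝ) ≤ N := fun v => Nat.cast_le.2 (hN ⟨v, rfl⟩)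
  let θ : P → C(I, A) := fun v => ⟨fun x => γ v (N * x), (hγc v).comp (by fun_prop)⟩
  refine ⟨T, θ, ?_, fun v => hγ₀ v _ (by simp), fun v => hγ₁ v _ (by simpa using hN v),
    fun v x => hγT v _, ?_⟩
  -- An arc cannot be the parent arc of both its ends: each would be one deeper than the other. So
  -- tree arcs correspond to the vertices other than the root.
  · have hinj : Function.Injective fun v : {v // v ≠ v₀} => jj v := by
      rintro ⟨v, hv⟩ ⟨w, hw⟩ h
      have h₁ := hdp v hv
      have h₂ := hdp w hw
      have h₃ := hjj v hv
      have h₄ := hjj w hw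
      simp only [h] at h₃
      ext
      rcases h₃ with ⟨a, b⟩ | ⟨a, b⟩ <;> rcases h₄ with ⟨a', b'⟩ | ⟨a', b'⟩
      · exact a.symm.trans a'
      · have e₁ := congrArg d (a.symm.trans a')
        have e₂ := congrArg d (b.symm.trans b')
        omega
      · have e₁ := congrArg d (a.symm.trans a')
        have e₂ := congrArg d (b.symm.trans b')
        omega
      · exact b.symm.trans b'
    have hr : T = Set.range fun v : {v // v ≠ v₀} => jj v := by
      ext j; simp [T]
    rw [hr, Nat.card_congr (Equiv.ofInjective _ hinj).symm,
      Nat.card_congr (Equiv.optionSubtypeNe v₀).symm, Finite.card_option]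
  · rintro _ ⟨v, hv, rfl⟩
    -- A point of the parent arc of `v` already lies on the track `γ v`, at time `u` or `1 - u`
    -- according to orientation. It then advances at speed `N`.
    have key : ∀ (o : C(I, ℝ)), (∀ u, 0 ≤ o u) → ∃ η : C(I, C(I, A)),
        ∀ u x, η u x = γ v (o u + N * x) := fun o _ =>
      ⟨pathMap (fun u x => γ v (o u + N * x)) ((hγc v).comp (by fun_prop)), fun _ _ => rfl⟩
    have hend : ∀ r : ℝ, 0 ≤ r → γ v (r + N * (1 : I)) = pt v₀ := fun r hr =>
      hγ₁ v _ (by have := hN v; simp; linarith)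
    have hpar : ∀ x : I, γ v (1 + N * x) = θ (par v) x := fun x =>
      hγ_add v hv _ (mul_nonneg N.cast_nonneg x.2.1)
    have hat : ∀ u : I, γ v u = τ v u := fun u => by
      rw [hγs v hv, if_pos u.2.2, clampI_coe]
    rcases hjj v hv with ⟨h, h'⟩ | ⟨h, h'⟩
    · obtain ⟨η, hη⟩ := key ⟨fun u => u, by fun_prop⟩ (fun u => u.2.1)
      refine ⟨η, ?_, ?_, fun u => ?_, fun u => ?_⟩
      · ext x; simp [hη, h, θ]
      · ext x; simp [hη, h', hpar]
      · rw [hη]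
        simp only [ContinuousMap.coe_mk, Set.Icc.coe_zero, mul_zero, add_zero]
        rw [hat]; simp only [τ, if_pos h]
      · rw [hη]; exact hend _ u.2.1
    · obtain ⟨η, hη⟩ := key ⟨fun u => (σ u : I), by fun_prop⟩ (fun u => (σ u).2.1)
      refine ⟨η, ?_, ?_, fun u => ?_, fun u => ?_⟩
      · ext x; simp [hη, h, hpar]
      · ext x; simp [hη, h', θ]
      · rw [hη]
        simp only [Set.Icc.coe_zero, mul_zero, add_zero]
        refine (hat (σ u)).trans ?_
        simp only [τ, if_neg (h.trans_ne (hne v hv)), unitInterval.symm_symm]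
      · rw [hη]; exact hend _ (σ u).2.1

end Tree

/-! ### Wedge sums -/

namespace Wedge

variable {ι Z : Type*} {X : ι → Type*} [∀ i, TopologicalSpace (X i)] [TopologicalSpace Z]
  (p : ∀ i, X i)

/-- The inclusion of a summand into the wedge sum. -/
def incl (i : ι) : C(X i, Wedge X p) :=
  ⟨fun x => Quot.mk _ (Sum.inr ⟨i, x⟩),
    continuous_quot_mk.comp (continuous_inr.comp continuous_sigmaMk)⟩

@[simp] theorem incl_point (i : ι) : incl p i (p i) = Wedge.base X p :=
  (Quot.sound (wedgeRel.glue i)).symm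

variable {p}

theorem ind {q : Wedge X p → Prop} (h₀ : q (Wedge.base X p)) (h : ∀ i x, q (incl p i x))
    (y : Wedge X p) : q y := by
  induction y using Quot.ind with
  | mk y => rcases y with y | ⟨i, x⟩; exacts [h₀, h i x]

/-- The universal property of the wedge sum. -/
def lift (z : Z) (φ : ∀ i, C(X i, Z)) (h : ∀ i, φ i (p i) = z) : C(Wedge X p, Z) where
  toFun := Quot.lift (Sum.elim (fun _ => z) (fun x => φ x.1 x.2)) (by
    rintro _ _ ⟨i⟩; exact (h i).symm)
  continuous_toFun := continuous_quot_lift _ (continuous_sum_dom.2 ⟨continuous_const,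
    continuous_sigma fun i => (φ i).continuous⟩)

@[simp] theorem lift_base (z : Z) (φ : ∀ i, C(X i, Z)) (h : ∀ i, φ i (p i) = z) :
    lift z φ h (Wedge.base X p) = z := rfl

@[simp] theorem lift_incl (z : Z) (φ : ∀ i, C(X i, Z)) (h : ∀ i, φ i (p i) = z) (i : ι) (x : X i) :
    lift z φ h (incl p i x) = φ i x := rfl

end Wedge

namespace WedgeTwo

variable {X Y Z : Type*} [TopologicalSpace X] [TopologicalSpace Y] [TopologicalSpace Z]

/-- The inclusion of the first summand. -/
def inl (x : X) (y : Y) : C(X, WedgeTwo x y) :=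
  ⟨fun a => Quot.mk _ (Sum.inl a), continuous_quot_mk.comp continuous_inl⟩

/-- The inclusion of the second summand. -/
def inr (x : X) (y : Y) : C(Y, WedgeTwo x y) :=
  ⟨fun a => Quot.mk _ (Sum.inr a), continuous_quot_mk.comp continuous_inr⟩

theorem inl_point (x : X) (y : Y) : inl x y x = inr x y y := Quot.sound wedgeTwoRel.glue

variable {x : X} {y : Y}

theorem ind {q : WedgeTwo x y → Prop} (hl : ∀ a, q (inl x y a)) (hr : ∀ a, q (inr x y a))
    (z : WedgeTwo x y) : q z := by
  induction z using Quot.ind with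
  | mk z => rcases z with z | z; exacts [hl z, hr z]

/-- The universal property of the wedge sum of two spaces. -/
def lift (φ : C(X, Z)) (ψ : C(Y, Z)) (h : φ x = ψ y) : C(WedgeTwo x y, Z) where
  toFun := Quot.lift (Sum.elim φ ψ) (by rintro _ _ ⟨⟩; exact h)
  continuous_toFun := continuous_quot_lift _ (continuous_sum_dom.2 ⟨φ.continuous, ψ.continuous⟩)

@[simp] theorem lift_inl (φ : C(X, Z)) (ψ : C(Y, Z)) (h : φ x = ψ y) (a : X) :
    lift φ ψ h (inl x y a) = φ a := rfl

@[simp] theorem lift_inr (φ : C(X, Z)) (ψ : C(Y, Z)) (h : φ x = ψ y) (a : Y) :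
    lift φ ψ h (inr x y a) = ψ a := rfl

end WedgeTwo

/-! ### The circle as a quotient of the interval -/

/-- The loop running once around the circle from `q`. -/
noncomputable def circleLoop (q : Circle) : C(I, Circle) :=
  ⟨fun u => q * Circle.exp (2 * Real.pi * u), by fun_prop⟩

@[simp] theorem circleLoop_zero (q : Circle) : circleLoop q 0 = q := by simp [circleLoop]

@[simp] theorem circleLoop_one (q : Circle) : circleLoop q 1 = q := by simp [circleLoop]

theorem circleLoop_surjective (q : Circle) : Function.Surjective (circleLoop q) := by
  intro z
  obtain ⟨x, hx⟩ := Circle.exp_surjective (q⁻¹ * z)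
  have hπ := Real.two_pi_pos
  refine ⟨⟨Int.fract (x / (2 * Real.pi)), Int.fract_nonneg _, (Int.fract_lt_one _).le⟩, ?_⟩
  have : Circle.exp (2 * Real.pi * Int.fract (x / (2 * Real.pi))) = Circle.exp x := by
    refine Circle.exp_eq_exp.2 ⟨-⌊x / (2 * Real.pi)⌋, ?_⟩
    rw [Int.fract, mul_sub, mul_div_cancel₀ _ hπ.ne']
    push_cast; ring
  simp [circleLoop, this, hx]

/-- Equal values force the parameters to differ by an integer, which lies in `{-1, 0, 1}` on
`[0,1]`; the extreme cases are the two ends. -/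
theorem circleLoop_eq {q : Circle} {u v : I} (h : circleLoop q u = circleLoop q v) :
    u = v ∨ (u = 0 ∧ v = 1) ∨ (u = 1 ∧ v = 0) := by
  have hπ := Real.two_pi_pos
  obtain ⟨m, hm⟩ := Circle.exp_eq_exp.1 (mul_left_cancel h)
  have hm' : (u : ℝ) = v + m := by
    refine mul_left_cancel₀ hπ.ne' ?_
    rw [hm]; ring
  have hu := u.2
  have hv := v.2
  have h₁ : m ≤ 1 := by
    have : (m : ℝ) ≤ 1 := by linarith [hu.2, hv.1]
    exact_mod_cast this
  have h₂ : -1 ≤ m := by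
    have : (-1 : ℝ) ≤ m := by linarith [hu.1, hv.2]
    exact_mod_cast this
  obtain rfl | rfl | rfl : m = -1 ∨ m = 0 ∨ m = 1 := by omega
  · refine Or.inr (Or.inl ⟨Subtype.ext ?_, Subtype.ext ?_⟩) <;> push_cast at hm' ⊢ <;>
      linarith [hu.1, hv.2]
  · exact Or.inl (Subtype.ext (by simpa using hm'))
  · refine Or.inr (Or.inr ⟨Subtype.ext ?_, Subtype.ext ?_⟩) <;> push_cast at hm' ⊢ <;>
      linarith [hu.2, hv.1]

/-- A closed path factors through the circle. -/
theorem exists_circle_lift {Z : Type*} [TopologicalSpace Z] (q : Circle) (γ : C(I, Z))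
    (h : γ 0 = γ 1) : ∃ F : C(Circle, Z), ∀ u, F (circleLoop q u) = γ u := by
  -- A continuous surjection from a compact space to a Hausdorff space is closed, hence a quotient
  -- map.
  have hq : Topology.IsQuotientMap (circleLoop q) :=
    (circleLoop q).continuous.isClosedMap.isQuotientMap (circleLoop q).continuous
      (circleLoop_surjective q)
  have hf : Function.FactorsThrough γ (circleLoop q) := by
    intro u v huv
    rcases circleLoop_eq huv with rfl | ⟨rfl, rfl⟩ | ⟨rfl, rfl⟩
    exacts [rfl, h, h.symm]
  exact ⟨hq.lift γ hf, fun u => DFunLike.congr_fun (hq.lift_comp γ hf) u⟩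

/-! ### Connected graphs of spaces -/

/-- Homotopies prescribed on the points `y v` extend to `B`. -/
def ExtendsHomotopies.{w, u, v} {P : Type v} {B : Type u} [TopologicalSpace B] (y : P → B) : Prop :=
  ∀ (Z : Type w) [TopologicalSpace Z] (φ : C(B, Z)) (γ : P → C(I, Z)), (∀ v, γ v 0 = φ (y v)) →
    ∃ H : C(B, C(I, Z)), (∀ b, H b 0 = φ b) ∧ ∀ v, H (y v) = γ v

/-- The map out of a disjoint union of intervals with given restrictions. -/
def arcsMap {J Z : Type*} [TopologicalSpace J] [DiscreteTopology J] [TopologicalSpace Z]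
    (ψ : J → C(I, Z)) : C(J × I, Z) :=
  ContinuousMap.uncurry ⟨ψ, continuous_of_discreteTopology⟩

@[simp] theorem arcsMap_apply {J Z : Type*} [TopologicalSpace J] [DiscreteTopology J]
    [TopologicalSpace Z] (ψ : J → C(I, Z)) (j : J) (u : I) : arcsMap ψ (j, u) = ψ j u := rfl

namespace HCoeq

universe u

/-- Arcs attached to a space `B` at finitely many points `y v`, in such a way that they connect all
these points: up to homotopy, this is the wedge of the quotient `B'` of `B` by the points `y v`
and of a bouquet of circles. -/
theorem nonempty_equiv_wedge_circles {B B' : Type u} {P J : Type} [TopologicalSpace B]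
    [TopologicalSpace B'] [Finite P] [Finite J] [TopologicalSpace J] [DiscreteTopology J]
    (y : P → B) (hy : ExtendsHomotopies.{u} y) (s t : J → P) (v₀ : P)
    (hconn : ∀ g : P → Prop, (∀ j, g (s j) ↔ g (t j)) → g v₀ → ∀ v, g v)
    (k : C(B, B')) (x₀ : B') (hk : ∀ v, k (y v) = x₀) (hk_surj : Function.Surjective k)
    (hk_lift : ∀ (Z : Type u) [TopologicalSpace Z] (φ : C(B, Z)) (z : Z), (∀ v, φ (y v) = z) →
      ∃ φ' : C(B', Z), ∀ b, φ' (k b) = φ b) :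
    ∃ n, n + Nat.card P = Nat.card J + 1 ∧ ∀ q : Fin n → Circle,
      Nonempty (HCoeq (fun j => y (s j)) (fun j => y (t j)) ≃ₕ
        WedgeTwo x₀ (Wedge.base (fun _ : Fin n => Circle) q)) := by
  classical
  set a := fun j => y (s j) with ha
  set b := fun j => y (t j) with hb
  obtain ⟨T, θ, hT, hθ₀, hθ₁, hθT, hη⟩ := exists_tree_contraction
    (fun v => base a b (y v)) (fun j => (cyl a b).comp ⟨fun u => (j, u), by fun_prop⟩) s t
    (fun j => by simp [ha]) (fun j => by simp [hb]) v₀ hconn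
  choose η hη₀ hη₁ hηi hηe using hη
  simp only [ContinuousMap.comp_apply, ContinuousMap.coe_mk] at hηi hθT
  let n := Nat.card {j // j ∉ T}
  have hn : Nat.card T + n = Nat.card J := by
    rw [← Nat.card_sum]; exact Nat.card_congr (Equiv.Set.sumCompl T)
  refine ⟨n, by omega, fun q => ?_⟩
  let ν : {j // j ∉ T} ≃ Fin n := Finite.equivFin _
  set x₁ := Wedge.base (fun _ : Fin n => Circle) q
  let loop : ∀ j, j ∉ T → C(I, WedgeTwo x₀ x₁) := fun j hj =>
    (WedgeTwo.inr x₀ x₁).comp ((Wedge.incl q (ν ⟨j, hj⟩)).comp (circleLoop (q (ν ⟨j, hj⟩))))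
  have hloop₀ : ∀ j hj, loop j hj 0 = WedgeTwo.inl x₀ x₁ x₀ := fun j hj => by
    simp [loop, WedgeTwo.inl_point, x₁]
  have hloop₁ : ∀ j hj, loop j hj 1 = WedgeTwo.inl x₀ x₁ x₀ := fun j hj => by
    simp [loop, WedgeTwo.inl_point, x₁]
  let f : C(HCoeq a b, WedgeTwo x₀ x₁) := lift ((WedgeTwo.inl x₀ x₁).comp k)
    (arcsMap fun j => if hj : j ∈ T then .const _ (WedgeTwo.inl x₀ x₁ x₀) else loop j hj)
    (fun j => by by_cases hj : j ∈ T <;> simp [hj, ha, hk, hloop₀])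
    (fun j => by by_cases hj : j ∈ T <;> simp [hj, hb, hk, hloop₁])
  have hfb : ∀ x, f (base a b x) = WedgeTwo.inl x₀ x₁ (k x) := fun _ => rfl
  have hfT : ∀ j u, j ∈ T → f (cyl a b (j, u)) = WedgeTwo.inl x₀ x₁ x₀ := fun j u hj => by
    simp [f, hj]
  have hfl : ∀ j u (hj : j ∉ T), f (cyl a b (j, u)) = loop j hj u := fun j u hj => by
    simp [f, hj]
  -- The contraction of the tree stays in the tree, which `f` collapses. This is why the image under
  -- `f` of the deformation of the source descends to the wedge.
  have hfθ : ∀ v x, f (θ v x) = WedgeTwo.inl x₀ x₁ x₀ := fun v x => by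
    rcases hθT v x with ⟨w, hw⟩ | ⟨j, hj, u, hw⟩
    · rw [hw, hfb, hk]
    · rw [hw, hfT _ _ hj]
  obtain ⟨H, hH₀, hHy⟩ := hy _ (base a b) θ hθ₀
  -- An arc prolonged at both ends by the tracks of its endpoints. At full length it is a loop at
  -- the root, and the circle of a non-tree arc is sent to it.
  let Γ : J → ℝ → HCoeq a b := fun j => ext3 (θ (s j)) (fun u => cyl a b (j, u)) (θ (t j))
  have hΓ₀ : ∀ j, θ (s j) 0 = cyl a b (j, 0) := fun j => by rw [hθ₀, cyl_zero]
  have hΓ₁ : ∀ j, θ (t j) 0 = cyl a b (j, 1) := fun j => by rw [hθ₀, cyl_one]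
  have hΓ : ∀ j, Continuous (Γ j) := fun j =>
    continuous_ext3 (X := ℝ) (α := fun _ => θ (s j)) (γ := fun _ u => cyl a b (j, u))
      (β := fun _ => θ (t j)) (by fun_prop) (by fun_prop) (by fun_prop) (fun _ => hΓ₀ j)
      (fun _ => hΓ₁ j) continuous_id
  have Γ_neg : ∀ j x, 0 ≤ x → Γ j (-x) = θ (s j) (clampI x) := fun j x hx => by
    simp only [Γ]; rw [ext3_of_nonpos (by linarith), neg_neg]
  have Γ_pos : ∀ j x, 0 ≤ x → Γ j (1 + x) = θ (t j) (clampI x) := fun j x hx => by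
    simp only [Γ]; rw [ext3_of_one_le (hΓ₁ j) (by linarith), add_sub_cancel_left]
  have Γ_coe : ∀ j (u : I), Γ j u = cyl a b (j, u) := fun j u => ext3_coe (hΓ₀ j) u
  have hfΓ : ∀ j (hj : j ∉ T) x, f (Γ j x) = loop j hj (clampI x) := fun j hj x => by
    rcases le_total x 0 with hx | hx
    · rw [clampI_of_nonpos hx, hloop₀, ← neg_neg x, Γ_neg _ _ (by linarith), hfθ]
    rcases le_total x 1 with hx' | hx'
    · rw [← hfl, ← Γ_coe, coe_clampI hx hx']
    · rw [clampI_of_one_le hx', hloop₁, ← add_sub_cancel 1 x, Γ_pos _ _ (by linarith), hfθ]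
  let w : I × I → ℝ := fun p => p.1 + p.2 * (2 * p.1 - 1)
  have hw : Continuous w := by fun_prop
  have w₀ : ∀ x : I, w (0, x) = -x := fun x => by simp [w]
  have w₁ : ∀ x : I, w (1, x) = 1 + x := fun x => by simp [w]; norm_num
  have wi : ∀ u : I, w (u, 0) = u := fun u => by simp [w]
  have Γ₀ : ∀ j (x : I), Γ j (w (0, x)) = θ (s j) x := fun j x => by
    rw [w₀, Γ_neg _ _ x.2.1, clampI_coe]
  have Γ₁ : ∀ j (x : I), Γ j (w (1, x)) = θ (t j) x := fun j x => by
    rw [w₁, Γ_pos _ _ x.2.1, clampI_coe]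
  -- At time `1` the extended homotopy `H` has moved every `y v` to the root, so it factors through
  -- the quotient `k`. The other lifts `h₁`, `g₂`, `h₂` arise in the same way.
  obtain ⟨g₁, hg₁⟩ := hk_lift _ ⟨fun x => H x 1, by fun_prop⟩ (base a b (y v₀))
    (fun v => by simp [hHy, hθ₁])
  simp only [ContinuousMap.coe_mk] at hg₁
  have hg₁x : g₁ x₀ = base a b (y v₀) := by rw [← hk v₀, hg₁, hHy, hθ₁]
  obtain ⟨h₁, hh₁⟩ := hk_lift _ (pathMap (fun x r => f (H x r)) (by fun_prop))
    (.const I (WedgeTwo.inl x₀ x₁ x₀)) (fun v => by ext r; simp [hHy, hfθ])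
  have hh₁x : h₁ x₀ = .const I (WedgeTwo.inl x₀ x₁ x₀) := by
    have := hh₁ (y v₀)
    rw [hk] at this
    rw [this]; ext r; simp [hHy, hfθ]
  have hg₂ : ∀ i : Fin n, ∃ F : C(Circle, HCoeq a b), ∀ u, F (circleLoop (q i) u) =
      Γ (ν.symm i) (w (u, 1)) := fun i => by
    refine exists_circle_lift (q i) ⟨fun u => Γ (ν.symm i) (w (u, 1)), (hΓ _).comp (by fun_prop)⟩ ?_
    simp only [ContinuousMap.coe_mk, Γ₀, Γ₁, hθ₁]
  choose g₂ hg₂ using hg₂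
  have hh₂ : ∀ i : Fin n, ∃ F : C(Circle, C(I, WedgeTwo x₀ x₁)), ∀ u, F (circleLoop (q i) u) =
      (pathMap (fun u x => f (Γ (ν.symm i) (w (u, x))))
        (f.continuous.comp ((hΓ _).comp hw)) : C(I, C(I, WedgeTwo x₀ x₁))) u := fun i => by
    refine exists_circle_lift (q i) _ ?_
    ext x
    simp only [pathMap_apply, Γ₀, Γ₁, hfθ]
  choose h₂ hh₂ using hh₂
  have hg₂q : ∀ i, g₂ i (q i) = base a b (y v₀) := fun i => by
    have := hg₂ i 0
    rwa [circleLoop_zero, Γ₀, hθ₁] at this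
  have hh₂q : ∀ i, h₂ i (q i) = .const I (WedgeTwo.inl x₀ x₁ x₀) := fun i => by
    have := hh₂ i 0
    rw [circleLoop_zero] at this
    rw [this]; ext x
    simp only [pathMap_apply, Γ₀, hfθ, ContinuousMap.const_apply]
  let g : C(WedgeTwo x₀ x₁, HCoeq a b) := WedgeTwo.lift g₁
    (Wedge.lift (base a b (y v₀)) g₂ hg₂q) (by simp [hg₁x, x₁])
  have hgl : ∀ x, g (WedgeTwo.inl x₀ x₁ x) = g₁ x := fun _ => rfl
  have hgb : g (WedgeTwo.inr x₀ x₁ x₁) = base a b (y v₀) := rfl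
  have hgr : ∀ i z, g (WedgeTwo.inr x₀ x₁ (Wedge.incl q i z)) = g₂ i z := fun _ _ => rfl
  let h : C(WedgeTwo x₀ x₁, C(I, WedgeTwo x₀ x₁)) := WedgeTwo.lift h₁
    (Wedge.lift (.const I (WedgeTwo.inl x₀ x₁ x₀)) h₂ hh₂q) (by simp [hh₁x, x₁])
  have hhl : ∀ x, h (WedgeTwo.inl x₀ x₁ x) = h₁ x := fun _ => rfl
  have hhb : ∀ r, h (WedgeTwo.inr x₀ x₁ x₁) r = WedgeTwo.inl x₀ x₁ x₀ := fun _ => rfl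
  have hhr : ∀ i z, h (WedgeTwo.inr x₀ x₁ (Wedge.incl q i z)) = h₂ i z := fun _ _ => rfl
  have hloop_ν : ∀ i u, loop (ν.symm i) (ν.symm i).2 u =
      WedgeTwo.inr x₀ x₁ (Wedge.incl q i (circleLoop (q i) u)) := fun i u => by
    simp [loop]
  refine nonempty_homotopyEquiv_of_paths f g
    (lift H (arcsMap fun j => if hj : j ∈ T then η j hj else
        pathMap (fun u x => Γ j (w (u, x))) ((hΓ j).comp hw)) (fun j => ?_) (fun j => ?_))
    (ind (by simpa using hH₀) fun j u => ?_) (ind (fun x => ?_) fun j u => ?_)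
    h (WedgeTwo.ind (fun x => ?_) (Wedge.ind ?_ fun i z => ?_))
    (WedgeTwo.ind (fun x => ?_) (Wedge.ind ?_ fun i z => ?_))
  · by_cases hj : j ∈ T
    · simp [hj, hη₀, ha, hHy]
    · ext x; simp [hj, Γ₀, ha, hHy]
  · by_cases hj : j ∈ T
    · simp [hj, hη₁, hb, hHy]
    · ext x; simp [hj, Γ₁, hb, hHy]
  · by_cases hj : j ∈ T
    · simp [hj, hηi]
    · simp [hj, wi, Γ_coe]
  · rw [lift_base, hfb]; exact (hg₁ x).symm
  · by_cases hj : j ∈ T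
    · rw [hfT _ _ hj, hgl, hg₁x]; simp [hj, hηe]
    · obtain ⟨i, hi⟩ := ν.symm.surjective ⟨j, hj⟩
      obtain rfl : (ν.symm i : J) = j := congrArg Subtype.val hi
      rw [hfl _ _ hj, hloop_ν, hgr, hg₂]
      simp [hj]
  · obtain ⟨x, rfl⟩ := hk_surj x
    rw [hhl, hh₁, pathMap_apply, hH₀, hfb]
  · exact (hhb 0).trans (WedgeTwo.inl_point x₀ x₁)
  · obtain ⟨u, rfl⟩ := circleLoop_surjective (q i) z
    rw [hhr, hh₂, pathMap_apply, wi, hfΓ _ (ν.symm i).2, clampI_coe, hloop_ν]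
  · obtain ⟨x, rfl⟩ := hk_surj x
    rw [hhl, hh₁, pathMap_apply, hgl, hg₁]
  · rw [hgb, hfb, hk]; exact hhb 1
  · obtain ⟨u, rfl⟩ := circleLoop_surjective (q i) z
    rw [hhr, hh₂, pathMap_apply, hgr, hg₂]

end HCoeq

/-! ### Nondegenerate points -/

/-- A point `p` such that there are a function `δ` vanishing only at `p` and a homotopy fixing `p`
which contracts the region `δ ≤ 1` to `p`. -/
def IsNDRPoint {X : Type*} [TopologicalSpace X] (p : X) : Prop :=
  ∃ (δ : C(X, ℝ)) (S : C(X, C(I, X))), (∀ x, 0 ≤ δ x) ∧ (∀ x, δ x = 0 ↔ x = p) ∧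
    (∀ x, S x 0 = x) ∧ (∀ t, S p t = p) ∧ ∀ x, δ x ≤ 1 → S x 1 = p

/-- Up to time `δ x`, contract along `S` with speed `1 / δ x`; after it, follow `γ` for the
remaining time. If the change happens at some `t ≤ 1`, then `δ x ≤ 1`, so `x` has arrived at `p`,
where `γ` starts. -/
theorem IsNDRPoint.exists_extension {X Z : Type*} [TopologicalSpace X] [TopologicalSpace Z] {p : X}
    (hp : IsNDRPoint p) (φ : C(X, Z)) (γ : C(I, Z)) (hγ : γ 0 = φ p) :
    ∃ H : C(X, C(I, Z)), (∀ x, H x 0 = φ x) ∧ H p = γ := by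
  obtain ⟨δ, S, hδ, hδ₀, hS₀, hSp, hS₁⟩ := hp
  let Q : X × I → X := fun q => S q.1 (clampI (q.2 / δ q.1))
  have hQ : Continuous Q := by
    refine continuous_iff_continuousAt.2 fun ⟨x, t⟩ => ?_
    -- At `p` the quotient `t / δ` has no control, but `S p` is constant: in the compact-open
    -- topology, the whole track of every nearby point stays in a given neighbourhood.
    by_cases hx : x = p
    · subst hx
      intro U hU
      have hQx : Q (x, t) = x := hSp _
      rw [hQx] at hU
      obtain ⟨U', hU', hUo, hxU⟩ := mem_nhds_iff.1 hU
      have hopen : IsOpen {z | Set.MapsTo (S z) Set.univ U'} :=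
        (ContinuousMap.isOpen_setOfPred_mapsTo isCompact_univ hUo).preimage S.continuous
      have hmem : {z | Set.MapsTo (S z) Set.univ U'} ∈ nhds x :=
        hopen.mem_nhds fun r _ => by rw [hSp]; exact hxU
      have := (continuous_fst (X := X) (Y := I)).continuousAt.preimage_mem_nhds
        (x := (x, t)) hmem
      exact Filter.mem_map.2
        (Filter.mem_of_superset this fun q (hq : Set.MapsTo _ _ _) => hU' (hq (Set.mem_univ _)))
    · have hx' : δ x ≠ 0 := fun h => hx ((hδ₀ x).1 h)
      have h₁ : ContinuousAt (fun q : X × I => (q.2 : ℝ) / δ q.1) (x, t) :=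
        ContinuousAt.div (by fun_prop) (by fun_prop) hx'
      have h₂ : ContinuousAt (fun q : X × I => (q.1, clampI ((q.2 : ℝ) / δ q.1))) (x, t) :=
        continuousAt_fst.prodMk (continuous_clampI.continuousAt.comp h₁)
      have h₃ : Continuous fun q : X × I => S q.1 q.2 := by fun_prop
      exact h₃.continuousAt.comp h₂
  have hQ₀ : ∀ x, Q (x, 0) = x := fun x => by simp [Q, hS₀]
  have hF : Continuous fun q : X × I =>
      if (q.2 : ℝ) ≤ δ q.1 then φ (Q q) else γ (clampI (q.2 - δ q.1)) := by
    refine Continuous.if_le (φ.continuous.comp hQ) (by fun_prop) (by fun_prop) (by fun_prop) ?_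
    rintro ⟨x, t⟩ (h : (t : ℝ) = δ x)
    rw [h, sub_self, clampI_zero, hγ]
    congr 1
    by_cases hx : δ x = 0
    · rw [(hδ₀ x).1 hx]; exact hSp _
    · simp only [Q]
      rw [h, div_self hx, clampI_one]
      exact hS₁ x (h ▸ t.2.2)
  refine ⟨pathMap (fun x t => if (t : ℝ) ≤ δ x then φ (Q (x, t)) else γ (clampI (t - δ x))) hF,
    fun x => ?_, ?_⟩
  · simp [hδ x, hQ₀]
  · have h0 : δ p = 0 := (hδ₀ p).2 rfl
    ext t
    simp only [pathMap_apply, h0, sub_zero, clampI_coe]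
    split_ifs with h
    · have : t = 0 := le_antisymm h t.2.1
      rw [this, hQ₀, hγ]
    · rfl

namespace Suspension

variable {X : Type*} [TopologicalSpace X]

/-- Poles and other points are treated together. Truncating `δ` at `2` makes `D` independent of `x`
at a pole other than `u₀`, where the height term is at least `2`. The cutoff `w` is `1` within `ε`
of `u₀` and `0` beyond `2ε`, so the push of heights towards `u₀` fixes the poles. -/
theorem isNDRPoint_mk_of {c₀ : X} {u₀ : I} {ε : ℝ} (hε : 0 < ε)
    (hu : ∀ u : I, u = 0 ∨ u = 1 → u = u₀ ∨ 2 * ε ≤ |(u - u₀ : ℝ)|)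
    (δ : C(X, ℝ)) (S : C(X, C(I, X))) (hδ : ∀ x, 0 ≤ δ x) (hδc : δ c₀ = 0)
    (hδ₀ : ∀ x, δ x = 0 → mk X (x, u₀) = mk X (c₀, u₀)) (hδu : u₀ = 0 ∨ u₀ = 1 → ∀ x, δ x = 0)
    (hS₀ : ∀ x, S x 0 = x) (hSp : ∀ t, mk X (S c₀ t, u₀) = mk X (c₀, u₀))
    (hS₁ : ∀ x, δ x ≤ 1 → mk X (S x 1, u₀) = mk X (c₀, u₀)) :
    IsNDRPoint (mk X (c₀, u₀)) := by
  let D : X × I → ℝ := fun q => max (|(q.2 - u₀ : ℝ)| / ε) (min (δ q.1) 2)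
  let w : I → ℝ := fun u => clampI (2 - |(u - u₀ : ℝ)| / ε)
  let m : I × I → I := fun q => clampI (q.1 + q.2 * w q.1 * (u₀ - q.1))
  have hDc : Continuous D := by fun_prop
  have hwc : Continuous w := by fun_prop
  have hm : Continuous m := by fun_prop
  have hD₂ : ∀ (u : I), u = 0 ∨ u = 1 → ∀ x y, D (x, u) = D (y, u) := by
    intro u hu' x y
    rcases hu u hu' with h | h
    · simp only [D, hδu (h ▸ hu')]
    · have h' : 2 ≤ |(u - u₀ : ℝ)| / ε := by rwa [le_div_iff₀ hε]
      simp only [D]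
      rw [max_eq_left ((min_le_right _ _).trans h'), max_eq_left ((min_le_right _ _).trans h')]
  have hm₂ : ∀ (u : I), u = 0 ∨ u = 1 → ∀ t, m (u, t) = u := by
    intro u hu' t
    rcases hu u hu' with rfl | h
    · simp [m]
    · have h' : 2 ≤ |(u - u₀ : ℝ)| / ε := by rwa [le_div_iff₀ hε]
      have : w u = 0 := by simp only [w]; rw [clampI_of_nonpos (by linarith)]; rfl
      simp [m, this]
  have hm0 : ∀ u, m (u, 0) = u := fun u => by simp [m]
  have hmu : ∀ t, m (u₀, t) = u₀ := fun t => by simp [m]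
  refine ⟨lift ⟨D, hDc⟩ (hD₂ 0 (Or.inl rfl)) (hD₂ 1 (Or.inr rfl)),
    lift (pathMap (fun q t => mk X (S q.1 t, m (q.2, t))) (by fun_prop))
      (fun x y => ?_) (fun x y => ?_), ind fun x u => ?_, ind fun x u => ⟨fun h => ?_, fun h => ?_⟩,
      ind fun x u => ?_, fun t => ?_, ind fun x u h => ?_⟩
  · ext t
    simp only [pathMap_apply, hm₂ 0 (Or.inl rfl)]
    exact mk_zero _ _
  · ext t
    simp only [pathMap_apply, hm₂ 1 (Or.inr rfl)]
    exact mk_one _ _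
  · exact le_max_of_le_right (le_min (hδ x) zero_le_two)
  · have h : D (x, u) = 0 := h
    have h₁ : |(u - u₀ : ℝ)| / ε ≤ 0 := h ▸ le_max_left _ _
    have h₂ : min (δ x) 2 ≤ 0 := h ▸ le_max_right _ _
    rw [div_le_iff₀ hε, zero_mul] at h₁
    obtain rfl : u = u₀ := Subtype.ext (sub_eq_zero.1 (abs_nonpos_iff.1 h₁))
    refine hδ₀ x (le_antisymm ?_ (hδ x))
    rcases min_le_iff.1 h₂ with h | h
    · exact h
    · norm_num at h
  · rw [h]
    change D (c₀, u₀) = 0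
    simp [D, hδc]
  · change mk X (S x 0, m (u, 0)) = _
    rw [hS₀, hm0]
  · change mk X (S c₀ t, m (u₀, t)) = _
    rw [hmu, hSp]
  · have h : D (x, u) ≤ 1 := h
    have h₁ : |(u - u₀ : ℝ)| / ε ≤ 1 := (le_max_left _ _).trans h
    have h₂ : min (δ x) 2 ≤ 1 := (le_max_right _ _).trans h
    have hw : w u = 1 := by simp only [w]; rw [clampI_of_one_le (by linarith)]; rfl
    have hm1 : m (u, 1) = u₀ := by simp [m, hw]
    change mk X (S x 1, m (u, 1)) = _
    rw [hm1]
    refine hS₁ x ?_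
    rcases min_le_iff.1 h₂ with h | h
    · exact h
    · norm_num at h

/-- All points of a suspension are nondegenerate if this holds for the space itself. -/
theorem isNDRPoint (hX : ∀ x : X, IsNDRPoint x) (p : Suspension X) : IsNDRPoint p := by
  induction p using ind with
  | h c₀ u₀ =>
  by_cases hu : u₀ = 0 ∨ u₀ = 1
  · have hmk : ∀ x y, mk X (x, u₀) = mk X (y, u₀) := fun x y => by
      rcases hu with rfl | rfl
      exacts [mk_zero x y, mk_one x y]
    -- At a pole the `X`-direction is already collapsed, so trivial data suffice; the other pole is
    -- at distance `1 = 2ε`.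
    refine isNDRPoint_mk_of (ε := 1 / 2) (by norm_num) ?_ (.const X 0) (constPaths X)
      (fun _ => le_rfl) rfl (fun x _ => hmk _ _) (fun _ _ => rfl) (fun _ => rfl)
      (fun _ => hmk _ _) (fun _ _ => hmk _ _)
    rcases hu with rfl | rfl <;> rintro u (rfl | rfl) <;> simp
  · rw [not_or] at hu
    obtain ⟨δ, S, hδ, hδ₀, hS₀, hSp, hS₁⟩ := hX c₀
    have h₀ : (0 : ℝ) < u₀ := lt_of_le_of_ne u₀.2.1 fun h => hu.1 (Subtype.ext h.symm)
    have h₁ : (u₀ : ℝ) < 1 := lt_of_le_of_ne u₀.2.2 fun h => hu.2 (Subtype.ext h)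
    refine isNDRPoint_mk_of (ε := min (u₀ : ℝ) (1 - u₀) / 2)
      (half_pos (lt_min h₀ (sub_pos.2 h₁))) ?_ δ S hδ ((hδ₀ _).2 rfl)
      (fun x hx => by rw [(hδ₀ x).1 hx]) (fun h => absurd h (not_or.2 hu)) hS₀
      (fun t => by rw [hSp]) (fun x hx => by rw [hS₁ x hx])
    rintro u (rfl | rfl) <;> refine Or.inr ?_ <;> rw [mul_div_cancel₀ _ two_ne_zero]
    · simp [abs_of_pos h₀]
    · simp [abs_of_pos (sub_pos.2 h₁)]

end Suspension

/-! ### Realizations of finite complexes -/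

/-- The least value of a function on a finite set (and `0` for the empty set). -/
noncomputable def faceMin {V : Type*} (N : Finset V) (x : V → ℝ) : ℝ :=
  if h : N.Nonempty then N.inf' h x else 0

section faceMin

variable {V : Type*} {N : Finset V}

@[fun_prop] theorem continuous_faceMin (N : Finset V) : Continuous (faceMin N) := by
  by_cases h : N.Nonempty
  · have : faceMin N = fun x => N.inf' h x := funext fun x => dif_pos h
    rw [this]
    exact Continuous.finset_inf'_apply h fun v _ => continuous_apply v
  · have : faceMin N = fun _ => 0 := funext fun x => dif_neg h
    rw [this]; exact continuous_const

theorem faceMin_le {x : V → ℝ} {v : V} (hv : v ∈ N) : faceMin N x ≤ x v := by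
  rw [faceMin, dif_pos ⟨v, hv⟩]; exact Finset.inf'_le _ hv

theorem lt_faceMin (hN : N.Nonempty) {x : V → ℝ} {r : ℝ} (h : ∀ v ∈ N, r < x v) :
    r < faceMin N x := by
  rw [faceMin, dif_pos hN]; exact (Finset.lt_inf'_iff _).2 h

theorem le_faceMin (hN : N.Nonempty) {x : V → ℝ} {r : ℝ} (h : ∀ v ∈ N, r ≤ x v) :
    r ≤ faceMin N x := by
  rw [faceMin, dif_pos hN]; exact Finset.le_inf' _ _ h

theorem faceMin_nonneg {x : V → ℝ} (h : ∀ v, 0 ≤ x v) : 0 ≤ faceMin N x := by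
  by_cases hN : N.Nonempty
  · exact le_faceMin hN fun v _ => h v
  · rw [faceMin, dif_neg hN]

end faceMin

namespace PreAbstractSimplicialComplex

variable {V : Type*} {K L M : PreAbstractSimplicialComplex V} {F : Finset V}

theorem nonempty_of_mem {s : Finset V} (hs : s ∈ K.faces) : s.Nonempty :=
  (K.isRelLowerSet_faces hs).1

theorem mem_of_subset {s t : Finset V} (hs : s ∈ K.faces) (hts : t ⊆ s) (ht : t.Nonempty) :
    t ∈ K.faces :=
  (K.isRelLowerSet_faces hs).2 hts ht

theorem mem_faces_iSup {ι : Sort*} {A : ι → PreAbstractSimplicialComplex V} {s : Finset V} :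
    s ∈ (⨆ i, A i).faces ↔ ∃ i, s ∈ (A i).faces := by
  change s ∈ ⋃ K ∈ Set.range A, K.faces ↔ _
  simp

theorem exists_vertices (hfin : K.faces.Finite) : ∃ F : Finset V, ∀ s ∈ K.faces, s ⊆ F := by
  classical
  exact ⟨hfin.toFinset.biUnion id, fun s hs =>
    Finset.subset_biUnion_of_mem id (hfin.mem_toFinset.2 hs)⟩

/-- Summing over a fixed finite vertex set separates normalization from the choice of a face. -/
theorem mem_realization_iff (hF : ∀ s ∈ K.faces, s ⊆ F) {x : V → ℝ} :
    x ∈ K.realization ↔ (∀ v, 0 ≤ x v) ∧ ∑ v ∈ F, x v = 1 ∧ ∃ s ∈ K.faces, ∀ v, v ∉ s → x v = 0 := by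
  constructor
  · rintro ⟨h, s, hs, hs₀, hs₁⟩
    exact ⟨h, (Finset.sum_subset (hF s hs) fun v _ => hs₀ v) ▸ hs₁, s, hs, hs₀⟩
  · rintro ⟨h, h₁, s, hs, hs₀⟩
    exact ⟨h, s, hs, hs₀, (Finset.sum_subset (hF s hs) fun v _ => hs₀ v).trans h₁⟩

theorem exists_support {x : V → ℝ} (hx : x ∈ K.realization) :
    ∃ s ∈ K.faces, ∀ v, v ∈ s ↔ 0 < x v := by
  classical
  obtain ⟨h, s, hs, hs₀, hs₁⟩ := hx
  have hmem : ∀ v, v ∈ s.filter (fun v => 0 < x v) ↔ 0 < x v := fun v => by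
    rw [Finset.mem_filter, and_iff_right_iff_imp]
    exact fun hv => by_contra fun hvs => hv.ne' (hs₀ v hvs)
  refine ⟨s.filter fun v => 0 < x v, mem_of_subset hs (Finset.filter_subset _ _) ?_, hmem⟩
  obtain ⟨v, -, hv⟩ := Finset.exists_lt_of_sum_lt (s := s) (f := fun _ => (0 : ℝ)) (g := x)
    (by simp [hs₁])
  exact ⟨v, (hmem v).2 hv⟩

theorem realization_mono (h : L ≤ M) : L.realization ⊆ M.realization := by
  rintro x ⟨h₀, s, hs, hx⟩
  exact ⟨h₀, s, h hs, hx⟩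

theorem mem_realization_sup {x : V → ℝ} :
    x ∈ (L ⊔ M).realization ↔ x ∈ L.realization ∨ x ∈ M.realization := by
  constructor
  · rintro ⟨h₀, s, hs | hs, hx⟩
    exacts [Or.inl ⟨h₀, s, hs, hx⟩, Or.inr ⟨h₀, s, hs, hx⟩]
  · rintro (h | h)
    exacts [realization_mono le_sup_left h, realization_mono le_sup_right h]

theorem mem_realization_iSup {ι : Sort*} {A : ι → PreAbstractSimplicialComplex V} {x : V → ℝ} :
    x ∈ (⨆ i, A i).realization ↔ ∃ i, x ∈ (A i).realization := by
  constructor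
  · rintro ⟨h₀, s, hs, hx⟩
    obtain ⟨i, hi⟩ := mem_faces_iSup.1 hs
    exact ⟨i, h₀, s, hi, hx⟩
  · rintro ⟨i, hi⟩
    exact realization_mono (le_iSup A i) hi

theorem mem_realization_inf {x : V → ℝ} :
    x ∈ (L ⊓ M).realization ↔ x ∈ L.realization ∧ x ∈ M.realization := by
  refine ⟨fun h => ⟨realization_mono inf_le_left h, realization_mono inf_le_right h⟩, ?_⟩
  rintro ⟨hL, hM⟩
  obtain ⟨s, hs, hsx⟩ := exists_support hL
  obtain ⟨t, ht, htx⟩ := exists_support hM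
  obtain rfl : s = t := Finset.ext fun v => (hsx v).trans (htx v).symm
  obtain ⟨h₀, r, hr, hr₀, hr₁⟩ := hL
  refine ⟨h₀, s, ⟨hs, ht⟩, fun v hv => ?_, ?_⟩
  · exact le_antisymm (not_lt.1 fun h => hv ((hsx v).2 h)) (h₀ v)
  · rw [← hr₁]
    refine Finset.sum_subset (fun v hv => ?_) fun v _ hv => ?_
    · exact by_contra fun h => ((hsx v).1 hv).ne' (hr₀ v h)
    · exact le_antisymm (not_lt.1 fun h => hv ((hsx v).2 h)) (h₀ v)

theorem realization_nonempty (h : K.faces.Nonempty) : K.realization.Nonempty := by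
  classical
  obtain ⟨s, hs⟩ := h
  obtain ⟨v, hv⟩ := nonempty_of_mem hs
  refine ⟨Pi.single v 1, fun w => ?_, s, hs, fun w hw => ?_, ?_⟩
  · by_cases h : w = v
    · subst h; simp
    · simp [h]
  · exact Pi.single_eq_of_ne (by rintro rfl; exact hw hv) _
  · simp [hv]

/-- `V` may be infinite, so each simplex is treated as a closed subset of the product of unit
intervals. -/
theorem isCompact_realization (hfin : K.faces.Finite) : IsCompact K.realization := by
  have hK : K.realization = ⋃ s ∈ K.faces,
      {x : V → ℝ | (∀ v, 0 ≤ x v) ∧ (∀ v, v ∉ s → x v = 0) ∧ ∑ v ∈ s, x v = 1} := by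
    ext x
    simp only [realization, Set.mem_ofPred_eq, Set.mem_iUnion, exists_prop]
    constructor
    · rintro ⟨h, s, hs, h'⟩; exact ⟨s, hs, h, h'⟩
    · rintro ⟨s, hs, h, h'⟩; exact ⟨h, s, hs, h'⟩
  rw [hK]
  refine hfin.isCompact_biUnion fun s _ => ?_
  refine (isCompact_univ_pi fun _ : V => isCompact_Icc (a := (0 : ℝ)) (b := 1)).of_isClosed_subset
    ?_ ?_
  · simp only [Set.ofPred_and, Set.ofPred_forall]
    refine (isClosed_iInter fun v => isClosed_le continuous_const (continuous_apply v)).inter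
      ((isClosed_iInter fun v => isClosed_iInter fun _ =>
        isClosed_eq (continuous_apply v) continuous_const).inter
      (isClosed_eq (by fun_prop) continuous_const))
  · rintro x ⟨h₀, hs, h₁⟩ v -
    refine ⟨h₀ v, ?_⟩
    by_cases hv : v ∈ s
    · exact h₁ ▸ Finset.single_le_sum (fun w _ => h₀ w) hv
    · rw [hs v hv]; exact zero_le_one

/-- The points of a finite complex are nondegenerate. -/
theorem isNDRPoint_realization (hfin : K.faces.Finite) (p : K.realization) : IsNDRPoint p := by
  obtain ⟨F, hF⟩ := exists_vertices hfin
  obtain ⟨s, hs, hsp⟩ := exists_support p.2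
  have hsne := nonempty_of_mem hs
  have hμ : 0 < faceMin s p := lt_faceMin hsne fun v hv => (hsp v).1 hv
  set μ := faceMin s p
  -- `s` is the face with `p` in its interior and `μ` the least weight of `p` on it. The cutoff `w`
  -- vanishes off the open star of `s` and is `1` once all weights on `s` are at least `μ / 2`.
  let w : (V → ℝ) → I := fun x => clampI (2 / μ * faceMin s x)
  have hw : Continuous w := by fun_prop
  obtain ⟨hp₀, hp₁, -⟩ := (mem_realization_iff hF).1 p.2
  have hmem : ∀ (x : K.realization) (t : I),
      (fun v => x.1 v + t * w x * (p.1 v - x.1 v)) ∈ K.realization := by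
    intro x t
    obtain ⟨hx₀, hx₁, r, hr, hxr⟩ := (mem_realization_iff hF).1 x.2
    have hc₀ : 0 ≤ (t : ℝ) * w x := mul_nonneg t.2.1 (w x).2.1
    have hc₁ : (t : ℝ) * w x ≤ 1 := mul_le_one₀ t.2.2 (w x).2.1 (w x).2.2
    refine (mem_realization_iff hF).2 ⟨fun v => ?_, ?_, r, hr, fun v hv => ?_⟩
    · have h₁ := mul_nonneg hc₀ (hp₀ v)
      have h₂ := mul_nonneg (sub_nonneg.2 hc₁) (hx₀ v)
      linarith
    · rw [Finset.sum_add_distrib, ← Finset.mul_sum, Finset.sum_sub_distrib, hx₁, hp₁]; simp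
    -- Inside the open star, any face carrying `x` contains `s`, so the segment to `p` stays in that
    -- face; outside, nothing moves.
    · by_cases hpos : 0 < faceMin s x
      · have hpv : p.1 v = 0 := by
          refine le_antisymm (not_lt.1 fun h => ?_) (hp₀ v)
          have := hpos.trans_le (faceMin_le ((hsp v).2 h))
          exact this.ne' (hxr v hv)
        rw [hxr v hv, hpv]; simp
      · have : w x = 0 := clampI_of_nonpos
          (mul_nonpos_of_nonneg_of_nonpos (by positivity) (not_lt.1 hpos))
        rw [this, hxr v hv]; simp
  -- The scaling makes `δ ≤ 1` mean total deviation at most `μ / 2`, which forces `w = 1`.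
  have hδ : Continuous fun x : K.realization => 2 / μ * ∑ v ∈ F, |x.1 v - p.1 v| :=
    continuous_const.mul (continuous_finsetSum _ fun v _ =>
      (((continuous_apply v).comp continuous_subtype_val).sub continuous_const).abs)
  refine ⟨⟨_, hδ⟩,
    pathMap (fun x t => ⟨_, hmem x t⟩) ?_, fun x => ?_, fun x => ⟨fun h => ?_, ?_⟩, fun x => ?_,
    fun t => ?_, fun x h => ?_⟩
  · refine Continuous.subtype_mk (continuous_pi fun v => ?_) _
    have h₁ : Continuous fun q : K.realization × I => q.1.1 v :=
      (continuous_apply v).comp (continuous_subtype_val.comp continuous_fst)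
    have h₂ : Continuous fun q : K.realization × I => (w q.1.1 : ℝ) :=
      continuous_subtype_val.comp (hw.comp (continuous_subtype_val.comp continuous_fst))
    fun_prop
  · exact mul_nonneg (by positivity) (Finset.sum_nonneg fun v _ => abs_nonneg _)
  · have h' : ∑ v ∈ F, |x.1 v - p.1 v| = 0 := (mul_eq_zero.1 h).resolve_left (by positivity)
    rw [Finset.sum_eq_zero_iff_of_nonneg fun v _ => abs_nonneg _] at h'
    obtain ⟨-, -, r, hr, hxr⟩ := (mem_realization_iff hF).1 x.2
    ext v
    by_cases hv : v ∈ F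
    · exact sub_eq_zero.1 (abs_eq_zero.1 (h' v hv))
    · obtain ⟨-, -, r', hr', hpr⟩ := (mem_realization_iff hF).1 p.2
      rw [hxr v fun h => hv (hF r hr h), hpr v fun h => hv (hF r' hr' h)]
  · rintro rfl; simp
  · ext v; simp
  · ext v; simp
  · have hsum : ∑ v ∈ F, |x.1 v - p.1 v| ≤ μ / 2 := by
      have h : 2 / μ * ∑ v ∈ F, |x.1 v - p.1 v| ≤ 1 := h
      rwa [div_mul_eq_mul_div, div_le_one hμ, ← le_div_iff₀' two_pos] at h
    have hmin : μ / 2 ≤ faceMin s x := le_faceMin hsne fun v hv => by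
      have h₁ : |x.1 v - p.1 v| ≤ ∑ v ∈ F, |x.1 v - p.1 v| :=
        Finset.single_le_sum (f := fun v => |x.1 v - p.1 v|) (fun w _ => abs_nonneg _) (hF s hs hv)
      have h₂ : μ ≤ p.1 v := faceMin_le hv
      have h₃ := (abs_le.1 (h₁.trans hsum)).1
      linarith
    have hw₁ : w x = 1 := clampI_of_one_le (by
      rw [div_mul_eq_mul_div, one_le_div hμ]; linarith)
    ext v
    simp [hw₁]


/-! ### Homotopy extension for subcomplexes and the double mapping cylinder -/

/-- The subspace of `(L ∪ M) × [0,1]` consisting of `L × 0`, `M × 1` and `(L ∩ M) × [0,1]`. -/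
def cylinderSpace (L M : PreAbstractSimplicialComplex V) : Set ((V → ℝ) × I) :=
  {q | (q.2 = 0 ∧ q.1 ∈ L.realization) ∨ (q.2 = 1 ∧ q.1 ∈ M.realization) ∨
    (q.1 ∈ L.realization ∧ q.1 ∈ M.realization)}

theorem mem_sup_of_mem_cylinderSpace {q : (V → ℝ) × I} (hq : q ∈ cylinderSpace L M) :
    q.1 ∈ (L ⊔ M).realization := by
  rcases hq with h | h | h
  exacts [mem_realization_sup.2 (Or.inl h.2), mem_realization_sup.2 (Or.inr h.2),
    mem_realization_sup.2 (Or.inl h.1)]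

/-- The homotopy extension property of `L ∩ M` in `M`, in the form of an explicit retraction: a
deformation `r` of the union of the complexes and a function `d` such that `(r, d)` is the
retraction onto `M × 0 ∪ (L ∩ M) × [0,1]`. -/
theorem exists_retraction (hfin : (L ⊔ M).faces.Finite) :
    ∃ (r : C((L ⊔ M).realization × I, (L ⊔ M).realization))
      (d : C((L ⊔ M).realization × I, ℝ)), (∀ x, r (x, 0) = x) ∧ (∀ x, d (x, 0) = 0) ∧
      (∀ x t, 0 ≤ d (x, t) ∧ d (x, t) ≤ t) ∧
      (∀ x t, x.1 ∈ L.realization → r (x, t) = x ∧ d (x, t) = t) ∧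
      (∀ x t, x.1 ∈ M.realization → (r (x, t)).1 ∈ M.realization ∧
        (d (x, t) = 0 ∨ (r (x, t)).1 ∈ L.realization)) := by
  classical
  obtain ⟨F, hF⟩ := exists_vertices hfin
  have hFL : ∀ s ∈ L.faces, s ⊆ F := fun s hs => hF s (Or.inl hs)
  have hFM : ∀ s ∈ M.faces, s ⊆ F := fun s hs => hF s (Or.inr hs)
  have hTfin : {N | N ∈ M.faces ∧ N ∉ L.faces}.Finite := hfin.subset fun N hN => Or.inr hN.1
  -- Small enough that subtracting `κ` from all weights leaves some weight positive: weights all at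
  -- most `κ` would sum to less than `1 / 2`.
  let κ : ℝ := 1 / (2 * (F.card + 1))
  have hκ : 0 < κ := by positivity
  have hκx : ∀ x ∈ (L ⊔ M).realization, ∃ v ∈ F, κ < x v := by
    intro x hx
    by_contra! h
    have h₁ := Finset.sum_le_card_nsmul F x κ h
    rw [((mem_realization_iff hF).1 hx).2.1, nsmul_eq_mul] at h₁
    have h₂ : (F.card + 1 : ℝ) * κ = 1 / 2 := by simp only [κ]; field_simp
    linarith
  -- `τ` vanishes on `L` and dominates `faceMin N` for every face `N` of `M` missing from `L`.
  -- Weights are lowered by `θ`, cut at `0` and renormalized.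
  let τ : (V → ℝ) → ℝ := fun x => ∑ N ∈ hTfin.toFinset, faceMin N x
  have hτc : Continuous τ := by fun_prop
  have hτ₀ : ∀ x : V → ℝ, (∀ v, 0 ≤ x v) → 0 ≤ τ x := fun x hx =>
    Finset.sum_nonneg fun N _ => faceMin_nonneg hx
  have hτL : ∀ x ∈ L.realization, τ x = 0 := by
    intro x hx
    refine Finset.sum_eq_zero fun N hN => le_antisymm ?_ (faceMin_nonneg hx.1)
    rw [Set.Finite.mem_toFinset] at hN
    obtain ⟨s, hs, hsx⟩ := exists_support hx
    obtain ⟨v, hvN, hvs⟩ : ∃ v ∈ N, v ∉ s := by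
      by_contra! h
      exact hN.2 (mem_of_subset hs h (nonempty_of_mem hN.1))
    exact (faceMin_le hvN).trans (not_lt.1 fun h => hvs ((hsx v).2 h))
  let θ : (V → ℝ) → I → ℝ := fun x t => min (t * κ) (τ x)
  let m : (V → ℝ) → I → V → ℝ := fun x t v => max (x v - θ x t) 0
  let Z : (V → ℝ) → I → ℝ := fun x t => ∑ v ∈ F, m x t v
  have hm : ∀ x t v, 0 ≤ m x t v := fun x t v => le_max_right _ _
  have hθκ : ∀ x (t : I), θ x t ≤ κ := fun x t =>
    (min_le_left _ _).trans (mul_le_of_le_one_left hκ.le t.2.2)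
  have hZ : ∀ x ∈ (L ⊔ M).realization, ∀ t, 0 < Z x t := by
    intro x hx t
    obtain ⟨v, hv, hvx⟩ := hκx x hx
    refine Finset.sum_pos' (fun w _ => hm x t w) ⟨v, hv, lt_max_of_lt_left ?_⟩
    have := hθκ x t
    linarith
  have hsum : ∀ x ∈ (L ⊔ M).realization, ∀ t, ∑ v ∈ F, m x t v / Z x t = 1 := by
    intro x hx t
    rw [← Finset.sum_div]; exact div_self (hZ x hx t).ne'
  have hθ₀ : ∀ x : V → ℝ, (∀ v, 0 ≤ x v) → ∀ t, 0 ≤ θ x t := fun x hx t =>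
    le_min (mul_nonneg t.2.1 hκ.le) (hτ₀ x hx)
  have hmem : ∀ N : PreAbstractSimplicialComplex V, N ≤ L ⊔ M → ∀ x ∈ N.realization, ∀ t,
      (fun v => m x t v / Z x t) ∈ N.realization := by
    intro N hN x hx t
    have hx' := realization_mono hN hx
    have hFN : ∀ s ∈ N.faces, s ⊆ F := fun s hs => hF s (hN hs)
    obtain ⟨hx₀, -, s, hs, hsx⟩ := (mem_realization_iff hFN).1 hx
    refine (mem_realization_iff hFN).2 ⟨fun v => div_nonneg (hm x t v) (hZ x hx' t).le,
      hsum x hx' t, s, hs, fun v hv => ?_⟩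
    have : m x t v = 0 := max_eq_right (by rw [hsx v hv]; linarith [hθ₀ x hx₀ t])
    rw [this, zero_div]
  have hid : ∀ x ∈ (L ⊔ M).realization, ∀ t, θ x t = 0 → (fun v => m x t v / Z x t) = x := by
    intro x hx t h
    obtain ⟨hx₀, hx₁, -⟩ := (mem_realization_iff hF).1 hx
    have hmx : ∀ v, m x t v = x v := fun v => by
      simp only [m, h, sub_zero]; exact max_eq_left (hx₀ v)
    have : Z x t = 1 := by simp only [Z, hmx, hx₁]
    ext v
    rw [hmx, this, div_one]
  have hL : ∀ x ∈ M.realization, ∀ t : I, τ x ≤ t * κ →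
      (fun v => m x t v / Z x t) ∈ L.realization := by
    intro x hx t ht
    have hx' : x ∈ (L ⊔ M).realization := realization_mono le_sup_right hx
    have hθτ : θ x t = τ x := min_eq_right ht
    obtain ⟨s, hs, hsx⟩ := exists_support (hmem M le_sup_right x hx t)
    have hsx' : ∀ v, v ∈ s ↔ τ x < x v := fun v => by
      rw [hsx, div_pos_iff_of_pos_right (hZ x hx' t)]
      simp [m, hθτ]
    -- Once the threshold reaches `τ x`, the surviving weights exceed it; on a missing face their
    -- minimum would exceed its own upper bound `τ x`.
    have hsL : s ∈ L.faces := by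
      by_contra h
      have h₁ : τ x < faceMin s x := lt_faceMin (nonempty_of_mem hs) fun v hv => (hsx' v).1 hv
      have h₂ : faceMin s x ≤ τ x := Finset.single_le_sum (f := fun N => faceMin N x)
        (fun N _ => faceMin_nonneg hx.1) (hTfin.mem_toFinset.2 ⟨hs, h⟩)
      linarith
    refine (mem_realization_iff hFL).2 ⟨(hmem M le_sup_right x hx t).1, hsum x hx' t, s, hsL, ?_⟩
    intro v hv
    exact le_antisymm (not_lt.1 fun h => hv ((hsx v).2 h)) ((hmem M le_sup_right x hx t).1 v)
  have hθc : Continuous fun q : (L ⊔ M).realization × I => θ q.1 q.2 := by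
    have h₁ : Continuous fun q : (L ⊔ M).realization × I => τ q.1 :=
      hτc.comp (continuous_subtype_val.comp continuous_fst)
    simp only [θ]
    fun_prop
  have hmc : ∀ v, Continuous fun q : (L ⊔ M).realization × I => m q.1 q.2 v := fun v => by
    have h₁ : Continuous fun q : (L ⊔ M).realization × I => q.1.1 v :=
      (continuous_apply v).comp (continuous_subtype_val.comp continuous_fst)
    simp only [m]
    fun_prop
  have hrc : Continuous fun q : (L ⊔ M).realization × I => fun v => m q.1 q.2 v / Z q.1 q.2 :=
    continuous_pi fun v => (hmc v).div (continuous_finsetSum _ fun w _ => hmc w)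
      fun q => (hZ q.1 q.1.2 q.2).ne'
  refine ⟨⟨fun q => ⟨_, hmem _ le_rfl q.1 q.1.2 q.2⟩, hrc.subtype_mk _⟩,
    ⟨fun q => max 0 (q.2 - τ q.1 / κ), ?_⟩, fun x => ?_, fun x => ?_, fun x t => ⟨?_, ?_⟩,
    fun x t hx => ⟨?_, ?_⟩, fun x t hx => ⟨hmem M le_sup_right x hx t, ?_⟩⟩
  · have h₁ : Continuous fun q : (L ⊔ M).realization × I => τ q.1 :=
      hτc.comp (continuous_subtype_val.comp continuous_fst)
    fun_prop
  · refine Subtype.ext (hid x x.2 0 ?_)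
    simp [θ, hτ₀ x x.2.1]
  · simp [div_nonneg (hτ₀ x x.2.1) hκ.le]
  · exact le_max_left _ _
  · exact max_le t.2.1 (sub_le_self _ (div_nonneg (hτ₀ x x.2.1) hκ.le))
  · refine Subtype.ext (hid x x.2 t ?_)
    simp [θ, hτL x hx, mul_nonneg t.2.1 hκ.le]
  · simp [hτL x hx, t.2.1]
  · rcases le_total (τ x) (t * κ) with h | h
    · exact Or.inr (hL x hx t h)
    · refine Or.inl (max_eq_left ?_)
      rwa [sub_nonpos, le_div_iff₀ hκ]

/-- Projection is inverted by `x ↦ (r (x, 1), 1 - d (x, 1))`, and a point of height `s` moves by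
running `r` and `d` up to time `t * s`. At `t = 1` this matches the composite: over `L` both give
`(x, 0)`, and every remaining point has `s = 1`. -/
theorem nonempty_equiv_cylinderSpace (hfin : (L ⊔ M).faces.Finite) :
    Nonempty ((L ⊔ M).realization ≃ₕ cylinderSpace L M) := by
  obtain ⟨r, d, hr₀, hd₀, hd, hL, hM⟩ := exists_retraction hfin
  let f : C(cylinderSpace L M, (L ⊔ M).realization) :=
    ⟨fun q => ⟨q.1.1, mem_sup_of_mem_cylinderSpace q.2⟩, by fun_prop⟩
  have hmem : ∀ (q : cylinderSpace L M) (t : I),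
      ((r (f q, t * q.1.2)).1, clampI (q.1.2 - d (f q, t * q.1.2))) ∈ cylinderSpace L M := by
    rintro ⟨⟨x, s⟩, hq⟩ t
    have hs := s.2
    rcases id hq with ⟨h, hx⟩ | ⟨h, hx⟩ | ⟨hx, hx'⟩
    · obtain rfl : s = 0 := h
      refine Or.inl ?_
      simpa [hr₀, hd₀, f] using hx
    · obtain rfl : s = 1 := h
      obtain ⟨h₁, h₂ | h₂⟩ := hM (f ⟨(x, 1), hq⟩) (t * 1) hx
      · exact Or.inr (Or.inl ⟨by simp only [h₂]; simp, h₁⟩)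
      · exact Or.inr (Or.inr ⟨h₂, h₁⟩)
    · refine Or.inr (Or.inr ?_)
      rw [(hL (f ⟨(x, s), hq⟩) _ hx).1]
      exact ⟨hx, hx'⟩
  have hgmem : ∀ x : (L ⊔ M).realization,
      ((r (x, 1)).1, clampI (1 - d (x, 1))) ∈ cylinderSpace L M := by
    intro x
    rcases mem_realization_sup.1 x.2 with hx | hx
    · rw [(hL x 1 hx).1, (hL x 1 hx).2]
      exact Or.inl ⟨by simp, hx⟩
    · obtain ⟨h₁, h₂ | h₂⟩ := hM x 1 hx
      · exact Or.inr (Or.inl ⟨by simp only [h₂]; simp, h₁⟩)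
      · exact Or.inr (Or.inr ⟨h₂, h₁⟩)
  let g : C((L ⊔ M).realization, cylinderSpace L M) := ⟨fun x => ⟨_, hgmem x⟩, by fun_prop⟩
  refine nonempty_homotopyEquiv_of_paths g f (pathMap (fun x t => r (x, t)) r.continuous) hr₀
    (fun x => rfl) (pathMap (fun q t => ⟨_, hmem q t⟩) (by fun_prop)) (fun q => ?_) (fun q => ?_)
  · refine Subtype.ext (Prod.ext ?_ ?_)
    · simp [hr₀, f]
    · simp [hd₀]
  · obtain ⟨⟨x, s⟩, hq⟩ := q
    refine Subtype.ext ?_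
    change ((r (f ⟨(x, s), hq⟩, 1 * s)).1, clampI (s - d (f ⟨(x, s), hq⟩, 1 * s))) =
      ((r (f ⟨(x, s), hq⟩, 1)).1, clampI (1 - d (f ⟨(x, s), hq⟩, 1)))
    rw [one_mul]
    have hLs : x ∈ L.realization →
        ((r (f ⟨(x, s), hq⟩, s)).1, clampI (s - d (f ⟨(x, s), hq⟩, s))) =
        ((r (f ⟨(x, s), hq⟩, 1)).1, clampI (1 - d (f ⟨(x, s), hq⟩, 1))) := fun hx => by
      rw [(hL _ s hx).1, (hL _ s hx).2, (hL _ 1 hx).1, (hL _ 1 hx).2]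
      simp
    rcases id hq with ⟨h, hx⟩ | ⟨h, hx⟩ | ⟨hx, -⟩
    · exact hLs hx
    · obtain rfl : s = 1 := h
      rfl
    · exact hLs hx

end PreAbstractSimplicialComplex

/-! ### Decomposition into components and the intersection graph -/

namespace PreAbstractSimplicialComplex

universe u

variable {V : Type u} {l m : ℕ} {A : Fin l → PreAbstractSimplicialComplex V}
  {B : Fin m → PreAbstractSimplicialComplex V}

theorem eq_of_mem_realization {ι : Type*} {A : ι → PreAbstractSimplicialComplex V}
    (hA : Pairwise fun i i' => Disjoint (A i) (A i')) {i i' : ι} {x : V → ℝ}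
    (hi : x ∈ (A i).realization) (hi' : x ∈ (A i').realization) : i = i' := by
  by_contra h
  obtain ⟨-, s, hs, -⟩ := mem_realization_inf.2 ⟨hi, hi'⟩
  exact (disjoint_iff_inf_le.1 (hA h)) hs

/-- The map attaching one end of the double mapping cylinder of the intersections of the `A i` with
the `B j` to the `A i`. -/
def leftAttach (A : Fin l → PreAbstractSimplicialComplex V)
    (B : Fin m → PreAbstractSimplicialComplex V) :
    C((Σ e : IntersectingPairs A B, (A e.1.1 ⊓ B e.1.2).realization),
      (Σ i, (A i).realization) ⊕ (Σ j, (B j).realization)) :=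
  sigmaMap fun e => ⟨fun x => Sum.inl ⟨e.1.1, x.1, realization_mono inf_le_left x.2⟩,
    continuous_inl.comp (continuous_sigmaMk.comp (by fun_prop))⟩

/-- The map attaching the other end of the double mapping cylinder to the `B j`. -/
def rightAttach (A : Fin l → PreAbstractSimplicialComplex V)
    (B : Fin m → PreAbstractSimplicialComplex V) :
    C((Σ e : IntersectingPairs A B, (A e.1.1 ⊓ B e.1.2).realization),
      (Σ i, (A i).realization) ⊕ (Σ j, (B j).realization)) :=
  sigmaMap fun e => ⟨fun x => Sum.inr ⟨e.1.2, x.1, realization_mono inf_le_right x.2⟩,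
    continuous_inr.comp (continuous_sigmaMk.comp (by fun_prop))⟩

/-- Disjointness means that a point determines its components, which gives a continuous bijection;
its source is compact and its target Hausdorff. -/
theorem nonempty_hcoeq_homeomorph (hfin : ((⨆ i, A i) ⊔ ⨆ j, B j).faces.Finite)
    (hA : Pairwise fun i i' => Disjoint (A i) (A i'))
    (hB : Pairwise fun j j' => Disjoint (B j) (B j')) :
    Nonempty (HCoeq (leftAttach A B) (rightAttach A B) ≃ₜ
      cylinderSpace (⨆ i, A i) (⨆ j, B j)) := by
  have cA : ∀ i, CompactSpace (A i).realization := fun i => isCompact_iff_compactSpace.1 <|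
    isCompact_realization (hfin.subset fun s hs => Or.inl (mem_faces_iSup.2 ⟨i, hs⟩))
  have cB : ∀ j, CompactSpace (B j).realization := fun j => isCompact_iff_compactSpace.1 <|
    isCompact_realization (hfin.subset fun s hs => Or.inr (mem_faces_iSup.2 ⟨j, hs⟩))
  have cC : ∀ e : IntersectingPairs A B, CompactSpace (A e.1.1 ⊓ B e.1.2).realization := fun e =>
    isCompact_iff_compactSpace.1 <| isCompact_realization
      (hfin.subset fun s hs => Or.inl (mem_faces_iSup.2 ⟨e.1.1, hs.1⟩))
  have hmA : ∀ i, ∀ x ∈ (A i).realization, x ∈ (⨆ i, A i).realization := fun i x hx =>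
    mem_realization_iSup.2 ⟨i, hx⟩
  have hmB : ∀ j, ∀ x ∈ (B j).realization, x ∈ (⨆ j, B j).realization := fun j x hx =>
    mem_realization_iSup.2 ⟨j, hx⟩
  have hS : Continuous fun c : Σ e : IntersectingPairs A B, (A e.1.1 ⊓ B e.1.2).realization =>
      c.2.1 := continuous_sigma fun e => continuous_subtype_val
  let Φ : C(HCoeq (leftAttach A B) (rightAttach A B), cylinderSpace (⨆ i, A i) (⨆ j, B j)) :=
    HCoeq.lift
      (sumMap
        (sigmaMap fun i => ⟨fun x => ⟨(x.1, 0), Or.inl ⟨rfl, hmA i x.1 x.2⟩⟩, by fun_prop⟩)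
        (sigmaMap fun j => ⟨fun x => ⟨(x.1, 1), Or.inr (Or.inl ⟨rfl, hmB j x.1 x.2⟩)⟩,
          by fun_prop⟩))
      ⟨fun q => ⟨(q.1.2.1, q.2), Or.inr (Or.inr
          ⟨hmA _ _ (mem_realization_inf.1 q.1.2.2).1, hmB _ _ (mem_realization_inf.1 q.1.2.2).2⟩)⟩,
        ((hS.comp continuous_fst).prodMk continuous_snd).subtype_mk _⟩
      (fun _ => rfl) (fun _ => rfl)
  let e := HCoeq.base (leftAttach A B) (rightAttach A B)
  let c := HCoeq.cyl (leftAttach A B) (rightAttach A B)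
  have hmk : ∀ i j x (hi : x ∈ (A i).realization) (hj : x ∈ (B j).realization),
      ∃ e : IntersectingPairs A B, e.1 = (i, j) ∧ x ∈ (A e.1.1 ⊓ B e.1.2).realization := by
    intro i j x hi hj
    have hx := mem_realization_inf.2 ⟨hi, hj⟩
    obtain ⟨-, s, hs, -⟩ := id hx
    exact ⟨⟨(i, j), s, hs⟩, rfl, hx⟩
  -- the fibre over a point is determined by the components to which it belongs
  have inj_cyl : ∀ (p p' : Σ e : IntersectingPairs A B, (A e.1.1 ⊓ B e.1.2).realization) (s : I),
      p.2.1 = p'.2.1 → c (p, s) = c (p', s) := by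
    rintro ⟨e, x⟩ ⟨e', x'⟩ s (h : x.1 = x'.1)
    have h₁ := mem_realization_inf.1 x.2
    have h₂ := mem_realization_inf.1 x'.2
    rw [h] at h₁
    obtain rfl : e = e' := Subtype.ext (Prod.ext (eq_of_mem_realization hA h₁.1 h₂.1)
      (eq_of_mem_realization hB h₁.2 h₂.2))
    rw [Subtype.ext h]
  have inj_left : ∀ (p p' : Σ i, (A i).realization), p.2.1 = p'.2.1 → p = p' := by
    rintro ⟨i, x⟩ ⟨i', x'⟩ (h : x.1 = x'.1)
    obtain rfl := eq_of_mem_realization hA (h ▸ x.2) x'.2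
    rw [Subtype.ext h]
  have inj_right : ∀ (p p' : Σ j, (B j).realization), p.2.1 = p'.2.1 → p = p' := by
    rintro ⟨i, x⟩ ⟨i', x'⟩ (h : x.1 = x'.1)
    obtain rfl := eq_of_mem_realization hB (h ▸ x.2) x'.2
    rw [Subtype.ext h]
  have key_left : ∀ (p : Σ i, (A i).realization)
      (p' : Σ e : IntersectingPairs A B, (A e.1.1 ⊓ B e.1.2).realization) (s : I),
      Φ (e (Sum.inl p)) = Φ (c (p', s)) → e (Sum.inl p) = c (p', s) := by
    intro p p' s h
    have h := congrArg Subtype.val h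
    obtain rfl : 0 = s := congrArg Prod.snd h
    refine Eq.trans ?_ (HCoeq.cyl_zero p').symm
    exact congrArg (fun z => e (Sum.inl z)) (inj_left _ _ (congrArg Prod.fst h))
  have key_right : ∀ (p : Σ j, (B j).realization)
      (p' : Σ e : IntersectingPairs A B, (A e.1.1 ⊓ B e.1.2).realization) (s : I),
      Φ (e (Sum.inr p)) = Φ (c (p', s)) → e (Sum.inr p) = c (p', s) := by
    intro p p' s h
    have h := congrArg Subtype.val h
    obtain rfl : 1 = s := congrArg Prod.snd h
    refine Eq.trans ?_ (HCoeq.cyl_one p').symm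
    exact congrArg (fun z => e (Sum.inr z)) (inj_right _ _ (congrArg Prod.fst h))
  have hinj : Function.Injective Φ := by
    refine HCoeq.ind ?_ fun p s => ?_
    · rintro (p | p) <;> refine HCoeq.ind ?_ fun p' s' => ?_
      · rintro (p' | p') h
        · exact congrArg (fun z => e (Sum.inl z))
            (inj_left _ _ (congrArg Prod.fst (congrArg Subtype.val h)))
        · exact absurd (congrArg Prod.snd (congrArg Subtype.val h)) zero_ne_one
      · exact key_left p p' s'
      · rintro (p' | p') h
        · exact absurd (congrArg Prod.snd (congrArg Subtype.val h)) one_ne_zero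
        · exact congrArg (fun z => e (Sum.inr z))
            (inj_right _ _ (congrArg Prod.fst (congrArg Subtype.val h)))
      · exact key_right p p' s'
    · refine HCoeq.ind ?_ fun p' s' h => ?_
      · rintro (p' | p') h
        exacts [(key_left p' p s h.symm).symm, (key_right p' p s h.symm).symm]
      · have h := congrArg Subtype.val h
        obtain rfl : s = s' := congrArg Prod.snd h
        exact inj_cyl p p' s (congrArg Prod.fst h)
  have hsurj : Function.Surjective Φ := by
    rintro ⟨⟨x, s⟩, hq⟩
    rcases id hq with ⟨h, hx⟩ | ⟨h, hx⟩ | ⟨hx, hx'⟩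
    · obtain rfl : s = 0 := h
      obtain ⟨i, hi⟩ := mem_realization_iSup.1 hx
      exact ⟨e (Sum.inl ⟨i, x, hi⟩), rfl⟩
    · obtain rfl : s = 1 := h
      obtain ⟨j, hj⟩ := mem_realization_iSup.1 hx
      exact ⟨e (Sum.inr ⟨j, x, hj⟩), rfl⟩
    · obtain ⟨i, hi⟩ := mem_realization_iSup.1 hx
      obtain ⟨j, hj⟩ := mem_realization_iSup.1 hx'
      obtain ⟨e, -, he⟩ := hmk i j x hi hj
      exact ⟨c (⟨e, x, he⟩, s), rfl⟩
  exact ⟨Continuous.homeoOfEquivCompactToT2 (f := Equiv.ofBijective Φ ⟨hinj, hsurj⟩) Φ.continuous⟩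

/-- The intersection graph of the covering of a connected complex by the `A i` and the `B j` is
connected. -/
theorem intersection_graph_connected (hconn : ConnectedSpace ((⨆ i, A i) ⊔ ⨆ j, B j).realization)
    (hfin : ((⨆ i, A i) ⊔ ⨆ j, B j).faces.Finite)
    (hA : Pairwise fun i i' => Disjoint (A i) (A i'))
    (hB : Pairwise fun j j' => Disjoint (B j) (B j'))
    (hAne : ∀ i, (A i).realization.Nonempty) (hBne : ∀ j, (B j).realization.Nonempty)
    (g : Fin l ⊕ Fin m → Prop)
    (hg : ∀ e : IntersectingPairs A B, g (Sum.inl e.1.1) ↔ g (Sum.inr e.1.2))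
    (w₀ : Fin l ⊕ Fin m) (hw₀ : g w₀) (w : Fin l ⊕ Fin m) : g w := by
  let N : Fin l ⊕ Fin m → PreAbstractSimplicialComplex V := Sum.elim A B
  have hNle : ∀ w, N w ≤ (⨆ i, A i) ⊔ ⨆ j, B j := by
    rintro (i | j)
    exacts [(le_iSup A i).trans le_sup_left, (le_iSup B j).trans le_sup_right]
  have hNfin : ∀ w, (N w).faces.Finite := fun w => hfin.subset (hNle w)
  have hNne : ∀ w, (N w).realization.Nonempty := by
    rintro (i | j); exacts [hAne i, hBne j]
  let S : (Fin l ⊕ Fin m → Prop) → Set ((⨆ i, A i) ⊔ ⨆ j, B j).realization := fun h =>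
    ⋃ w ∈ {w | h w}, Subtype.val ⁻¹' (N w).realization
  have hSc : ∀ h, IsClosed (S h) := fun h => (Set.toFinite _).isClosed_biUnion fun w _ =>
    (isCompact_realization (hNfin w)).isClosed.preimage continuous_subtype_val
  have hint : ∀ i j x, x ∈ (A i).realization → x ∈ (B j).realization →
      (g (Sum.inl i) ↔ g (Sum.inr j)) := fun i j x hi hj => by
    obtain ⟨-, s, hs, -⟩ := mem_realization_inf.2 ⟨hi, hj⟩
    exact hg ⟨(i, j), s, hs⟩
  have hiff : ∀ w w' x, x ∈ (N w).realization → x ∈ (N w').realization → (g w ↔ g w') := by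
    rintro (i | j) (i' | j') x hx hx'
    · rw [eq_of_mem_realization hA hx hx']
    · exact hint _ _ x hx hx'
    · exact (hint _ _ x hx' hx).symm
    · rw [eq_of_mem_realization hB hx hx']
  have hcov : ∀ x : ((⨆ i, A i) ⊔ ⨆ j, B j).realization, ∃ w, x.1 ∈ (N w).realization := by
    intro x
    rcases mem_realization_sup.1 x.2 with h | h
    · obtain ⟨i, hi⟩ := mem_realization_iSup.1 h; exact ⟨Sum.inl i, hi⟩
    · obtain ⟨j, hj⟩ := mem_realization_iSup.1 h; exact ⟨Sum.inr j, hj⟩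
  have hmem : ∀ h w (x : ((⨆ i, A i) ⊔ ⨆ j, B j).realization), h w → x.1 ∈ (N w).realization →
      x ∈ S h := fun h w x hw hx => Set.mem_biUnion (show w ∈ {w | h w} from hw) hx
  -- Intersecting pieces have the same `g`-value, so the pieces with `g` and those without form two
  -- complementary finite unions of closed sets; connectedness leaves only the first.
  have hcompl : S g = (S fun w => ¬ g w)ᶜ := by
    ext x
    constructor
    · intro hx hx'
      obtain ⟨w, hw, hwx⟩ := Set.mem_iUnion₂.1 hx
      obtain ⟨w', hw', hwx'⟩ := Set.mem_iUnion₂.1 hx'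
      exact hw' ((hiff w w' _ hwx hwx').1 hw)
    · intro hx
      obtain ⟨w, hw⟩ := hcov x
      exact hmem g w x (by_contra fun h => hx (hmem _ w x h hw)) hw
  have hclopen : IsClopen (S g) := ⟨hSc g, hcompl ▸ (hSc _).isOpen_compl⟩
  obtain ⟨x₀, hx₀⟩ := hNne w₀
  have huniv := hclopen.eq_univ ⟨⟨x₀, realization_mono (hNle w₀) hx₀⟩, hmem g w₀ _ hw₀ hx₀⟩
  obtain ⟨x, hx⟩ := hNne w
  have hxS : (⟨x, realization_mono (hNle w) hx⟩ : ((⨆ i, A i) ⊔ ⨆ j, B j).realization) ∈ S g :=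
    huniv ▸ Set.mem_univ _
  obtain ⟨w', hw', hwx'⟩ := Set.mem_iUnion₂.1 hxS
  exact (hiff w' w x hwx' hx).1 hw'

end PreAbstractSimplicialComplex

/-! ### Contracting the components and choosing base points -/

theorem ContractibleSpace.exists_contraction (X : Type*) [TopologicalSpace X]
    [ContractibleSpace X] :
    ∃ (x₀ : X) (κ : C(X, C(I, X))), (∀ x, κ x 0 = x) ∧ ∀ x, κ x 1 = x₀ := by
  obtain ⟨x₀, ⟨H⟩⟩ := id_nullhomotopic X
  exact ⟨x₀, pathMap (fun x t => H (t, x)) (by fun_prop), fun x => by simp, fun x => by simp⟩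

/-- The path follows a meridian through `p`. It serves to slide the end of an arc from a pole to an
arbitrary base point. -/
theorem Suspension.exists_path_zero {X : Type*} [TopologicalSpace X] (c : X) (p : Suspension X) :
    ∃ γ : C(I, Suspension X), γ 0 = mk X (c, 0) ∧ γ 1 = p := by
  induction p using Suspension.ind with
  | h x s =>
    refine ⟨⟨fun t => mk X (x, t * s), by fun_prop⟩, ?_, ?_⟩
    · simpa using mk_zero x c
    · simp

theorem Suspension.exists_path_one {X : Type*} [TopologicalSpace X] (c : X) (p : Suspension X) :
    ∃ γ : C(I, Suspension X), γ 0 = mk X (c, 1) ∧ γ 1 = p := by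
  induction p using Suspension.ind with
  | h x s =>
    refine ⟨⟨fun t => mk X (x, σ (t * σ s)), by fun_prop⟩, ?_, ?_⟩
    · simpa using mk_one x c
    · simp

namespace PreAbstractSimplicialComplex

universe u

variable {V : Type u} {l m : ℕ} {A : Fin l → PreAbstractSimplicialComplex V}
  {B : Fin m → PreAbstractSimplicialComplex V}

/-- The poles of the suspensions of the intersections are connected by arcs to the components. -/
theorem nonempty_hcoeq_equiv_suspensionGraph
    (hAc : ∀ i, ContractibleSpace (A i).realization)
    (hBc : ∀ j, ContractibleSpace (B j).realization)
    (c₀ : ∀ e : IntersectingPairs A B, (A e.1.1 ⊓ B e.1.2).realization) :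
    Nonempty (HCoeq (leftAttach A B) (rightAttach A B) ≃ₕ
      HCoeq (C := IntersectingPairs A B ⊕ IntersectingPairs A B)
        (B := (Fin l ⊕ Fin m) ⊕
          Σ e : IntersectingPairs A B, Suspension (A e.1.1 ⊓ B e.1.2).realization)
        (Sum.elim (fun e => Sum.inr ⟨e, Suspension.mk _ (c₀ e, 0)⟩)
          (fun e => Sum.inr ⟨e, Suspension.mk _ (c₀ e, 1)⟩))
        (Sum.elim (fun e => Sum.inl (Sum.inl e.1.1)) (fun e => Sum.inl (Sum.inr e.1.2)))) := by
  choose xA κA hA₀ hA₁ using fun i => ContractibleSpace.exists_contraction (A i).realization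
  choose xB κB hB₀ hB₁ using fun j => ContractibleSpace.exists_contraction (B j).realization
  refine HCoeq.nonempty_equiv_suspensionGraph (leftAttach A B) (rightAttach A B)
    (W := Fin l ⊕ Fin m)
    (sumMap (sigmaMap fun i => .const _ (Sum.inl i)) (sigmaMap fun j => .const _ (Sum.inr j)))
    ⟨Sum.elim (fun i => Sum.inl ⟨i, xA i⟩) (fun j => Sum.inr ⟨j, xB j⟩),
      continuous_of_discreteTopology⟩
    (sumMap
      (sigmaMap fun i => pathMap (fun x t => Sum.inl ⟨i, κA i x t⟩)
        (continuous_inl.comp (continuous_sigmaMk.comp (by fun_prop))))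
      (sigmaMap fun j => pathMap (fun x t => Sum.inr ⟨j, κB j x t⟩)
        (continuous_inr.comp (continuous_sigmaMk.comp (by fun_prop)))))
    ?_ ?_ ?_ ?_ (fun e => Sum.inl e.1.1) (fun e => Sum.inr e.1.2) (fun _ => rfl) (fun _ => rfl) c₀
  · rintro (⟨i, x⟩ | ⟨j, x⟩)
    · simp [hA₀]
    · simp [hB₀]
  · rintro (⟨i, x⟩ | ⟨j, x⟩)
    · simp [hA₁]
    · simp [hB₁]
  · rintro (⟨i, x⟩ | ⟨j, x⟩) t <;> rfl
  · rintro (i | j) <;> rfl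

/-- The nondegenerate points `p e` of the summands, together with further isolated points, have the
homotopy extension property. -/
theorem extendsHomotopies_sum {W E : Type} {X : E → Type u} [TopologicalSpace W]
    [DiscreteTopology W] [∀ e, TopologicalSpace (X e)] (p : ∀ e, X e)
    (hp : ∀ e, IsNDRPoint (p e)) :
    ExtendsHomotopies.{u} (P := W ⊕ E) (B := W ⊕ Σ e, X e)
      (Sum.elim Sum.inl fun e => Sum.inr ⟨e, p e⟩) := by
  intro Z _ φ γ hγ
  choose H hH₀ hH using fun e => (hp e).exists_extension
    (φ.comp ⟨fun x => Sum.inr ⟨e, x⟩, continuous_inr.comp continuous_sigmaMk⟩) (γ (Sum.inr e))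
    (hγ (Sum.inr e))
  refine ⟨sumMap ⟨fun w => γ (Sum.inl w), continuous_of_discreteTopology⟩ (sigmaMap H), ?_, ?_⟩
  · rintro (w | ⟨e, x⟩)
    exacts [hγ (Sum.inl w), hH₀ e x]
  · rintro (w | e)
    exacts [rfl, hH e]

end PreAbstractSimplicialComplex

/-! ### Assembling the equivalences -/

open PreAbstractSimplicialComplex in
theorem mainTheorem12 {V : Type*} (K L M : PreAbstractSimplicialComplex V)
    (hfin : K.faces.Finite) (hconn : ConnectedSpace K.realization) (hK : K = L ⊔ M)
    (l m : ℕ)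
    (A : Fin l → PreAbstractSimplicialComplex V) (B : Fin m → PreAbstractSimplicialComplex V)
    (hL : L = ⨆ i, A i) (hM : M = ⨆ j, B j)
    (hA : Pairwise fun i i' => Disjoint (A i) (A i'))
    (hB : Pairwise fun j j' => Disjoint (B j) (B j'))
    (hAc : ∀ i, ContractibleSpace (A i).realization)
    (hBc : ∀ j, ContractibleSpace (B j).realization) :
    ∃ n : ℕ, (n : ℤ) = (Nat.card (IntersectingPairs A B) : ℤ) - l - m + 1 ∧
      -- the base points of the wedge summands are arbitrary
      ∀ (p : ∀ ij : IntersectingPairs A B, Suspension (A ij.1.1 ⊓ B ij.1.2).realization)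
        (q : Fin n → Circle),
        Nonempty (K.realization ≃ₕ
          WedgeTwo
            (Wedge.base
              (fun ij : IntersectingPairs A B => Suspension (A ij.1.1 ⊓ B ij.1.2).realization) p)
            (Wedge.base (fun _ : Fin n => Circle) q)) := by
  subst hK hL hM
  let X : IntersectingPairs A B → Type _ := fun e =>
    Suspension (A e.1.1 ⊓ B e.1.2).realization
  have hne : ∀ e : IntersectingPairs A B, (A e.1.1 ⊓ B e.1.2).realization.Nonempty := fun e =>
    realization_nonempty e.2
  choose c₀ hc₀ using hne
  obtain ⟨w₀⟩ : Nonempty (Fin l ⊕ Fin m) := by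
    obtain ⟨x⟩ := hconn.toNonempty
    rcases mem_realization_sup.1 x.2 with h | h
    · exact ⟨Sum.inl (mem_realization_iSup.1 h).choose⟩
    · exact ⟨Sum.inr (mem_realization_iSup.1 h).choose⟩
  have hXNDR : ∀ e (x : X e), IsNDRPoint x := fun e => Suspension.isNDRPoint
    (isNDRPoint_realization (hfin.subset fun s hs => Or.inl (mem_faces_iSup.2 ⟨e.1.1, hs.1⟩)))
  -- Each pair contributes one vertex, for its suspension, and two arcs, one to each component. This
  -- is the barycentric subdivision of the intersection graph.
  let src : IntersectingPairs A B ⊕ IntersectingPairs A B →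
      (Fin l ⊕ Fin m) ⊕ IntersectingPairs A B := Sum.elim Sum.inr Sum.inr
  let tgt : IntersectingPairs A B ⊕ IntersectingPairs A B →
      (Fin l ⊕ Fin m) ⊕ IntersectingPairs A B :=
    Sum.elim (fun e => Sum.inl (Sum.inl e.1.1)) (fun e => Sum.inl (Sum.inr e.1.2))
  have hgraph : ∀ g : (Fin l ⊕ Fin m) ⊕ IntersectingPairs A B → Prop,
      (∀ j, g (src j) ↔ g (tgt j)) → g (Sum.inl w₀) → ∀ v, g v := by
    intro g hg h₀
    have hw : ∀ w, g (Sum.inl w) := intersection_graph_connected hconn hfin hA hB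
      (fun i => Set.nonempty_coe_sort.1 inferInstance) (fun j => Set.nonempty_coe_sort.1 inferInstance)
       (fun w => g (Sum.inl w))
      (fun e => (hg (Sum.inl e)).symm.trans (hg (Sum.inr e))) w₀ h₀
    rintro (w | e)
    exacts [hw w, (hg (Sum.inl e)).2 (hw _)]
  have collapse := fun p : ∀ e, X e => HCoeq.nonempty_equiv_wedge_circles
    (Sum.elim Sum.inl fun e => Sum.inr ⟨e, p e⟩)
    (extendsHomotopies_sum (W := Fin l ⊕ Fin m) p fun e => hXNDR e (p e)) src tgt (Sum.inl w₀)
    hgraph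
    (sumMap (.const _ (Wedge.base X p)) (sigmaMap fun e => Wedge.incl p e)) (Wedge.base X p)
    (by rintro (w | e) <;> simp)
    (Wedge.ind ⟨Sum.inl w₀, rfl⟩ fun e x => ⟨Sum.inr ⟨e, x⟩, rfl⟩)
    (fun Z _ φ z hz => ⟨Wedge.lift z
      (fun e => φ.comp ⟨fun x => Sum.inr ⟨e, x⟩, continuous_inr.comp continuous_sigmaMk⟩)
      (fun e => by exact hz (Sum.inr e)), by
        rintro (w | ⟨e, x⟩)
        exacts [(hz (Sum.inl w)).symm, rfl]⟩)
  -- `n` must be fixed before the base points, so it is read off for an auxiliary choice; the count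
  -- equation then gives the same number for every `p`.
  obtain ⟨n, hn, -⟩ := collapse fun e => Suspension.mk _ (⟨c₀ e, hc₀ e⟩, 0)
  refine ⟨n, ?_, fun p q => ?_⟩
  · simp only [Nat.card_sum, Nat.card_fin] at hn
    omega
  obtain ⟨n', hn', hcol⟩ := collapse p
  obtain rfl : n = n' := by omega
  obtain ⟨e₁⟩ := nonempty_equiv_cylinderSpace hfin
  obtain ⟨e₂⟩ := nonempty_hcoeq_homeomorph hfin hA hB
  obtain ⟨e₃⟩ := nonempty_hcoeq_equiv_suspensionGraph hAc hBc fun e => ⟨c₀ e, hc₀ e⟩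
  choose γ₀ hγ₀ hγ₀' using fun e => Suspension.exists_path_zero (⟨c₀ e, hc₀ e⟩) (p e)
  choose γ₁ hγ₁ hγ₁' using fun e => Suspension.exists_path_one (⟨c₀ e, hc₀ e⟩) (p e)
  let ins : ∀ e, C(X e, (Fin l ⊕ Fin m) ⊕ Σ e, X e) := fun e =>
    ⟨fun x => Sum.inr ⟨e, x⟩, continuous_inr.comp continuous_sigmaMk⟩
  -- Both arcs of a pair slide along meridians from the two poles to the single point `p e`; their
  -- other ends stay fixed.
  obtain ⟨e₄⟩ := HCoeq.nonempty_equiv_of_homotopy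
    (C := IntersectingPairs A B ⊕ IntersectingPairs A B) (B := (Fin l ⊕ Fin m) ⊕ Σ e, X e)
    ⟨Sum.elim (fun e => (ins e).comp (γ₀ e)) (fun e => (ins e).comp (γ₁ e)),
      continuous_of_discreteTopology⟩
    ⟨Sum.elim (fun e => .const I (Sum.inl (Sum.inl e.1.1)))
      (fun e => .const I (Sum.inl (Sum.inr e.1.2))), continuous_of_discreteTopology⟩
  obtain ⟨e₃'⟩ := HCoeq.nonempty_equiv_of_eq (B := (Fin l ⊕ Fin m) ⊕ Σ e, X e)
    (a := Sum.elim (fun e => Sum.inr ⟨e, Suspension.mk _ (⟨c₀ e, hc₀ e⟩, 0)⟩)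
      (fun e => Sum.inr ⟨e, Suspension.mk _ (⟨c₀ e, hc₀ e⟩, 1)⟩))
    (b := Sum.elim (fun e => Sum.inl (Sum.inl e.1.1)) (fun e => Sum.inl (Sum.inr e.1.2)))
    (a' := fun j => (Sum.elim (fun e => (ins e).comp (γ₀ e)) (fun e => (ins e).comp (γ₁ e)) j :
      C(I, _)) 0)
    (b' := fun j => (Sum.elim (fun e => .const I (Sum.inl (Sum.inl e.1.1)))
      (fun e => .const I (Sum.inl (Sum.inr e.1.2))) j : C(I, _)) 0)
    (by rintro (e | e) <;> simp [ins, hγ₀, hγ₁]) (by rintro (e | e) <;> simp)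
  obtain ⟨e₅⟩ := HCoeq.nonempty_equiv_of_eq (B := (Fin l ⊕ Fin m) ⊕ Σ e, X e)
    (a := fun j => (Sum.elim (fun e => (ins e).comp (γ₀ e)) (fun e => (ins e).comp (γ₁ e)) j :
      C(I, _)) 1)
    (b := fun j => (Sum.elim (fun e => .const I (Sum.inl (Sum.inl e.1.1)))
      (fun e => .const I (Sum.inl (Sum.inr e.1.2))) j : C(I, _)) 1)
    (a' := fun j => (Sum.elim Sum.inl fun e => Sum.inr ⟨e, p e⟩ :
      (Fin l ⊕ Fin m) ⊕ IntersectingPairs A B → (Fin l ⊕ Fin m) ⊕ Σ e, X e) (src j))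
    (b' := fun j => (Sum.elim Sum.inl fun e => Sum.inr ⟨e, p e⟩ :
      (Fin l ⊕ Fin m) ⊕ IntersectingPairs A B → (Fin l ⊕ Fin m) ⊕ Σ e, X e) (tgt j))
    (by rintro (e | e) <;> simp [ins, src, hγ₀', hγ₁'])
    (by rintro (e | e) <;> simp [tgt])
  obtain ⟨e₆⟩ := hcol q
  exact ⟨e₁.trans <| e₂.symm.toHomotopyEquiv.trans <| e₃.trans <| e₃'.trans <| e₄.trans <|
    e₅.trans e₆⟩
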